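/- For $n\ge 1$ let $\mathcal C_n(\mathbb R)$ be the associative unital $\mathbb R$-algebra generated by $i_1,\dots,i_{n-1}$ subject to the relations $i_h^2=-1$ and $i_hi_k=-i_ki_h$ for $h\ne k$, and let $V^n(\mathbb Z)=\mathbb Z+\mathbb Z i_1+\dots+\mathbb Z i_{n-1}\subset\mathcal C_n(\mathbb R)$. The elementary group $\mathrm E_2(\Gamma_n(\mathbb Z))$ is the group of invertible $2\times 2$ matrices over $\mathcal C_n(\mathbb R)$ generated by the matrices $E(x)=\begin{pmatrix}x&1\\-1&0\end{pmatrix}$ with $x\in V^n(\mathbb Z)$. For $n\ge 2$ the inclusion $\mathcal C_{n-1}(\mathbb R)\to\mathcal C_n(\mathbb R)$, $i_h\mapsto i_h$, induces a homomorphism $\mathrm E_2(\Gamma_{n-1}(\mathbb Z))\to\mathrm E_2(\Gamma_n(\mathbb Z))$. Given injective group homomorphisms $f_1:H\to G_1$ and $f_2:H\to G_2$, the amalgamated free product $G_1*_HG_2$ is the quotient of the free product $G_1*G_2$ by the normal subgroup generated by the elements $f_1(h)f_2(h)^{-1}$, $h\in H$; it is called non-trivial if neither $f_1$ nor $f_2$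 is surjective, and $H$ is called the amalgamated subgroup. **Theorem.** (1) For every $n\ge 1$, the group $\mathrm E_2(\Gamma_n(\mathbb Z))$ is isomorphic to a non-trivial amalgamated free product. (2) For every $n\ge 2$, there are groups $G_1,G_2$, injective and non-surjective homomorphisms $\mathrm E_2(\Gamma_{n-1}(\mathbb Z))\to G_1$ and $\mathrm E_2(\Gamma_{n-1}(\mathbb Z))\to G_2$, and an isomorphism $$G_1*_{\mathrm E_2(\Gamma_{n-1}(\mathbb Z))}G_2\;\cong\;\mathrm E_2(\Gamma_n(\mathbb Z))$$ whose restriction to the amalgamated subgroup is the homomorphism $\mathrm E_2(\Gamma_{n-1}(\mathbb Z))\to\mathrm E_2(\Gamma_n(\mathbb Z))$ above. (3) $\mathrm E_2(\Gamma_1(\mathbb Z))\cong\mathrm{SL}_2(\mathbb Z)$, and $\mathrm E_2(\Gamma_1(\mathbb Z))\cong C_4*_{C_2}C_6$, where $C_k$ is the cyclic group of order $k$ and $C_2$ embeds in both factors. -/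

import Mathlib

noncomputable section

/-! ### Free products with amalgamation -/

section Amalgam

variable {H G₁ G₂ : Type*} [Group H] [Group G₁] [Group G₂]

/-- The normal subgroup of the free product `G₁ * G₂` generated by the elements
`f₁ h * (f₂ h)⁻¹`, for `h : H`. -/
def amalgamKernel (f₁ : H →* G₁) (f₂ : H →* G₂) : Subgroup (Monoid.Coprod G₁ G₂) :=
  Subgroup.normalClosure
    (Set.range fun h : H => Monoid.Coprod.inl (f₁ h) * (Monoid.Coprod.inr (f₂ h))⁻¹)

instance amalgamKernel_normal (f₁ : H →* G₁) (f₂ : H →* G₂) : (amalgamKernel f₁ f₂).Normal :=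
  Subgroup.normalClosure_normal

/-- The free product of `G₁` and `G₂` with amalgamated subgroup `H`, the latter being mapped to
the factors by `f₁` and `f₂`. -/
abbrev Amalgam (f₁ : H →* G₁) (f₂ : H →* G₂) : Type _ :=
  Monoid.Coprod G₁ G₂ ⧸ amalgamKernel f₁ f₂

/-- The canonical map from the amalgamated subgroup to the amalgamated product. -/
def Amalgam.base (f₁ : H →* G₁) (f₂ : H →* G₂) : H →* Amalgam f₁ f₂ :=
  (QuotientGroup.mk' (amalgamKernel f₁ f₂)).comp (Monoid.Coprod.inl.comp f₁)

end Amalgam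

/-- `E` is a non-trivial free product with amalgamation `G₁ *_H G₂` (the maps from `H` to the
factors are injective and neither of them is surjective), and under this identification the
amalgamated subgroup `H` sits in `E` through `j : H →* E`. -/
def IsNontrivialAmalgamOver {H E : Type} [Group H] [Group E] (j : H →* E) : Prop :=
  ∃ (G₁ G₂ : Type) (_ : Group G₁) (_ : Group G₂) (f₁ : H →* G₁) (f₂ : H →* G₂),
    Function.Injective f₁ ∧ Function.Injective f₂ ∧
    ¬ Function.Surjective f₁ ∧ ¬ Function.Surjective f₂ ∧
    ∃ e : Amalgam f₁ f₂ ≃* E, ∀ h : H, e (Amalgam.base f₁ f₂ h) = j h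

/-- `E` is a non-trivial free product with amalgamation, over some amalgamated subgroup. -/
def IsNontrivialAmalgam (E : Type) [Group E] : Prop :=
  ∃ (H : Type) (_ : Group H) (j : H →* E), IsNontrivialAmalgamOver j

/-! ### The Clifford algebra and the elementary group -/

/-- The quadratic form `-(x₁² + ⋯ + xₙ₋₁²)` on `ℝⁿ⁻¹`. -/
def cliffForm (n : ℕ) : QuadraticForm ℝ (Fin (n - 1) → ℝ) :=
  QuadraticMap.weightedSumSquares ℝ fun _ => (-1 : ℝ)

/-- The real Clifford algebra generated by `n - 1` anticommuting elements of square `-1`. -/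
abbrev Cliff (n : ℕ) : Type := CliffordAlgebra (cliffForm n)

/-- The generators `i₁, …, iₙ₋₁` of the Clifford algebra. -/
def cliffGen (n : ℕ) (h : Fin (n - 1)) : Cliff n :=
  CliffordAlgebra.ι (cliffForm n) (Pi.single h 1)

/-- The lattice `Vⁿ(ℤ)` spanned over `ℤ` by `1, i₁, …, iₙ₋₁`. -/
def cliffVec (n : ℕ) : Submodule ℤ (Cliff n) :=
  Submodule.span ℤ (insert 1 (Set.range (cliffGen n)))

/-- The matrix `E(x)` with rows `(x, 1)` and `(-1, 0)`, as an invertible matrix. -/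
def elemMat {R : Type*} [Ring R] (x : R) : (Matrix (Fin 2) (Fin 2) R)ˣ where
  val := !![x, 1; -1, 0]
  inv := !![0, -1; 1, x]
  val_inv := by ext i j; fin_cases i <;> fin_cases j <;> simp [Matrix.mul_apply, Fin.sum_univ_two]
  inv_val := by ext i j; fin_cases i <;> fin_cases j <;> simp [Matrix.mul_apply, Fin.sum_univ_two]

/-- The elementary group `E₂(Γₙ(ℤ))`: the group of invertible `2 × 2` matrices over the real
Clifford algebra generated by the `E(x)` with `x ∈ Vⁿ(ℤ)`. -/
def E2Γ (n : ℕ) : Subgroup (Matrix (Fin 2) (Fin 2) (Cliff n))ˣ :=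
  Subgroup.closure (elemMat '' (cliffVec n : Set (Cliff n)))

/-! ### The inclusion `E₂(Γₘ(ℤ)) → E₂(Γₙ(ℤ))` for `m ≤ n` -/

/-- Extension of vectors by zero, as an isometry for the Clifford forms. -/
def cliffFormIncl {m n : ℕ} (h : m ≤ n) : cliffForm m →qᵢ cliffForm n where
  toLinearMap := Function.ExtendByZero.linearMap ℝ (Fin.castLE (Nat.sub_le_sub_right h 1))
  map_app' := by
    intro v
    have hinj := Fin.castLE_injective (Nat.sub_le_sub_right h 1)
    simp only [cliffForm, QuadraticMap.weightedSumSquares_apply]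
    symm
    refine Fintype.sum_of_injective _ hinj _ _ ?_ ?_
    · intro i hi
      have : Function.extend (Fin.castLE (Nat.sub_le_sub_right h 1)) v 0 i = 0 := by
        rw [Function.extend_apply']
        · rfl
        · exact hi
      simp [this]
    · intro i
      have := hinj.extend_apply v 0 i
      simp [this]

/-- The inclusion of Clifford algebras; it sends `i_h` to `i_h`. -/
def cliffIncl {m n : ℕ} (h : m ≤ n) : Cliff m →ₐ[ℝ] Cliff n :=
  CliffordAlgebra.map (cliffFormIncl h)

theorem cliffIncl_gen {m n : ℕ} (h : m ≤ n) (k : Fin (m - 1)) :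
    cliffIncl h (cliffGen m k) = cliffGen n (Fin.castLE (Nat.sub_le_sub_right h 1) k) := by
  have hinj := Fin.castLE_injective (Nat.sub_le_sub_right h 1)
  simp only [cliffIncl, cliffGen, CliffordAlgebra.map_apply_ι]
  congr 1
  change Function.extend (Fin.castLE (Nat.sub_le_sub_right h 1)) (Pi.single k 1) 0 = _
  ext i
  by_cases hi : ∃ a, Fin.castLE (Nat.sub_le_sub_right h 1) a = i
  · obtain ⟨a, rfl⟩ := hi
    rw [hinj.extend_apply]
    simp [Pi.single_apply]
  · rw [Function.extend_apply' _ _ _ hi, Pi.single_apply, if_neg]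
    · rfl
    · exact fun hk => hi ⟨k, hk.symm⟩

theorem cliffIncl_mem {m n : ℕ} (h : m ≤ n) {x : Cliff m} (hx : x ∈ cliffVec m) :
    cliffIncl h x ∈ cliffVec n := by
  induction hx using Submodule.span_induction with
  | mem x hx =>
    rcases hx with rfl | ⟨k, rfl⟩
    · rw [map_one]
      exact Submodule.subset_span (Set.mem_insert _ _)
    · rw [cliffIncl_gen]
      exact Submodule.subset_span (Set.mem_insert_of_mem _ ⟨_, rfl⟩)
  | zero => simp
  | add x y _ _ hx hy => rw [map_add]; exact add_mem hx hy
  | smul a x _ hx => rw [map_zsmul]; exact Submodule.smul_mem _ a hx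

/-- The entrywise inclusion of invertible matrices. -/
def matIncl {m n : ℕ} (h : m ≤ n) :
    (Matrix (Fin 2) (Fin 2) (Cliff m))ˣ →* (Matrix (Fin 2) (Fin 2) (Cliff n))ˣ :=
  Units.map ((cliffIncl h).toRingHom.mapMatrix : _ →+* Matrix (Fin 2) (Fin 2) (Cliff n))

theorem matIncl_elemMat {m n : ℕ} (h : m ≤ n) (x : Cliff m) :
    matIncl h (elemMat x) = elemMat (cliffIncl h x) := by
  ext i j
  fin_cases i <;> fin_cases j <;> simp [matIncl, elemMat]

theorem matIncl_mem {m n : ℕ} (h : m ≤ n) (g : E2Γ m) : matIncl h g ∈ E2Γ n := by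
  have : E2Γ m ≤ (E2Γ n).comap (matIncl h) := by
    refine (Subgroup.closure_le _).2 ?_
    rintro _ ⟨x, hx, rfl⟩
    change matIncl h (elemMat x) ∈ E2Γ n
    rw [matIncl_elemMat]
    exact Subgroup.subset_closure ⟨_, cliffIncl_mem h hx, rfl⟩
  exact this g.2

/-- The inclusion `E₂(Γₘ(ℤ)) → E₂(Γₙ(ℤ))`, for `m ≤ n`, sending `E(x)` to `E(x)`. -/
def E2ΓIncl {m n : ℕ} (h : m ≤ n) : E2Γ m →* E2Γ n :=
  ((matIncl h).comp (E2Γ m).subtype).codRestrict (E2Γ n) (matIncl_mem h)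

end

/-! Write `n = m + 2`. A matrix `g` acts on the hermitian `2 × 2` matrices over `Vⁿ(ℤ)` by `X ↦ g X
g*`, preserving a Lorentzian form and the cone of positive semidefinite matrices, which is the
action on hyperbolic space. The matrices `E(0)` and `E(e)`, with `e` a unit vector, generate the
group and act as products of an even number of reflections in the walls `|x|² + t² = 1`, `xⱼ = 0`,
`xⱼ = 1/2` (`acts_elemMat_zero`, `acts_elemMat_paraUnit`); only `1` and `-1` act trivially
(`Acts.eq_one_or_eq_neg_one`).

In this reflection group the wall `x_last = 0` is orthogonal to every other wall except its parallel
`x_last = 1/2`, and the product of the reflections in these two has infinite order. So the images of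
the wall `x_last = 0` do not cross and their dual graph is a tree. The group should therefore split
along the stabilizer of the wall with its two sides, which is the image `wallGroup` of the smaller
elementary group. One factor, `flipGroup`, is the stabilizer of the wall and the other,
`shiftGroup`, that of the slab cut out next to it by its images; each is generated by `wallGroup`
and one more rotation.

No tree is constructed. The splitting follows from a ping-pong lemma, `exists_amalgam_mulEquiv`, for
a group acting on a strictly ordered set. The two sides of the wall are encoded by the vectors
`wallVec` and `-wallVec`, and inclusion of half-spaces by the Loewner order `hermLT`. The main point
is `mem_wallGroup_or_hermLT`: an element of `shiftGroup` outside `wallGroup` moves `-wallVec`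
strictly below `wallVec`. It rests on the Coxeter-theoretic fact `RootFamily.rep_root_mem_positive`,
that an element which `s_b` lengthens on the right maps the root of `b` to a positive combination of
simple roots; `RootFamily.mem_parabolic_or` turns this into a quantitative statement.

For `n = 1` the same ping-pong lemma is applied to `SL₂(ℤ)` acting on sets of integer vectors, the
order being strict inclusion. -/

noncomputable section

/-! ### Reduced expressions in amalgamated products and a ping-pong lemma. -/

section PingPong

variable {H G₁ G₂ E X : Type*} [Group H] [Group G₁] [Group G₂] [Group E]

/-- Elements of an amalgamated product admitting a reduced expression; the index records whether
the expression is empty, or the factor of its leftmost letter (`false` for `G₁`). -/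
inductive Amalgam.Reduced (f₁ : H →* G₁) (f₂ : H →* G₂) : Option Bool → Amalgam f₁ f₂ → Prop
  | base (h : H) : Reduced f₁ f₂ none (Amalgam.base f₁ f₂ h)
  | left (g : G₁) (x : Amalgam f₁ f₂) (o : Option Bool) (hg : g ∉ f₁.range) (ho : o ≠ some false)
      (hx : Reduced f₁ f₂ o x) :
      Reduced f₁ f₂ (some false) (QuotientGroup.mk' (amalgamKernel f₁ f₂) (Monoid.Coprod.inl g) * x)
  | right (g : G₂) (x : Amalgam f₁ f₂) (o : Option Bool) (hg : g ∉ f₂.range) (ho : o ≠ some true)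
      (hx : Reduced f₁ f₂ o x) :
      Reduced f₁ f₂ (some true) (QuotientGroup.mk' (amalgamKernel f₁ f₂) (Monoid.Coprod.inr g) * x)

theorem Amalgam.base_eq_inl (f₁ : H →* G₁) (f₂ : H →* G₂) (h : H) :
    Amalgam.base f₁ f₂ h = QuotientGroup.mk' (amalgamKernel f₁ f₂) (Monoid.Coprod.inl (f₁ h)) :=
  rfl

theorem Amalgam.base_eq_inr (f₁ : H →* G₁) (f₂ : H →* G₂) (h : H) :
    Amalgam.base f₁ f₂ h = QuotientGroup.mk' (amalgamKernel f₁ f₂) (Monoid.Coprod.inr (f₂ h)) := by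
  rw [Amalgam.base_eq_inl]
  simp only [QuotientGroup.mk'_apply]
  rw [QuotientGroup.eq_iff_div_mem, div_eq_mul_inv]
  exact Subgroup.subset_normalClosure ⟨h, rfl⟩

/-- An element of `H` is absorbed into the leftmost letter, which stays outside the image of `H`. -/
theorem Amalgam.Reduced.base_mul {f₁ : H →* G₁} {f₂ : H →* G₂} {o : Option Bool}
    {x : Amalgam f₁ f₂} (hx : Amalgam.Reduced f₁ f₂ o x) (h : H) :
    Amalgam.Reduced f₁ f₂ o (Amalgam.base f₁ f₂ h * x) := by
  cases hx with
  | base k => rw [← map_mul]; exact .base _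
  | left g x o hg ho hx =>
    rw [Amalgam.base_eq_inl, ← mul_assoc, ← map_mul, ← map_mul]
    exact .left _ _ o (fun hk => hg
      ((Subgroup.mul_mem_cancel_left _ (MonoidHom.mem_range.2 ⟨h, rfl⟩)).1 hk)) ho hx
  | right g x o hg ho hx =>
    rw [Amalgam.base_eq_inr, ← mul_assoc, ← map_mul, ← map_mul]
    exact .right _ _ o (fun hk => hg
      ((Subgroup.mul_mem_cancel_left _ (MonoidHom.mem_range.2 ⟨h, rfl⟩)).1 hk)) ho hx

/-- A leftmost letter from the same factor is merged with `g`; the product either is a new letter or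
lies in the image of `H` and is absorbed by the rest. -/
theorem Amalgam.Reduced.inl_mul {f₁ : H →* G₁} {f₂ : H →* G₂} {o : Option Bool}
    {x : Amalgam f₁ f₂} (hx : Amalgam.Reduced f₁ f₂ o x) (g : G₁) :
    ∃ o', Amalgam.Reduced f₁ f₂ o'
      (QuotientGroup.mk' (amalgamKernel f₁ f₂) (Monoid.Coprod.inl g) * x) := by
  have key : ∀ (g : G₁) (y : Amalgam f₁ f₂) (o : Option Bool), o ≠ some false →
      Amalgam.Reduced f₁ f₂ o y → ∃ o', Amalgam.Reduced f₁ f₂ o'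
      (QuotientGroup.mk' (amalgamKernel f₁ f₂) (Monoid.Coprod.inl g) * y) := by
    intro g y o ho hy
    by_cases hg : g ∈ f₁.range
    · obtain ⟨h, rfl⟩ := hg
      exact ⟨o, hy.base_mul h⟩
    · exact ⟨_, .left g y o hg ho hy⟩
  by_cases ho : o = some false
  · subst ho
    cases hx with
    | left g' y o' hg' ho' hy =>
      rw [← mul_assoc, ← map_mul, ← map_mul]
      exact key _ _ _ ho' hy
  · exact key g x o ho hx

theorem Amalgam.Reduced.inr_mul {f₁ : H →* G₁} {f₂ : H →* G₂} {o : Option Bool}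
    {x : Amalgam f₁ f₂} (hx : Amalgam.Reduced f₁ f₂ o x) (g : G₂) :
    ∃ o', Amalgam.Reduced f₁ f₂ o'
      (QuotientGroup.mk' (amalgamKernel f₁ f₂) (Monoid.Coprod.inr g) * x) := by
  have key : ∀ (g : G₂) (y : Amalgam f₁ f₂) (o : Option Bool), o ≠ some true →
      Amalgam.Reduced f₁ f₂ o y → ∃ o', Amalgam.Reduced f₁ f₂ o'
      (QuotientGroup.mk' (amalgamKernel f₁ f₂) (Monoid.Coprod.inr g) * y) := by
    intro g y o ho hy
    by_cases hg : g ∈ f₂.range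
    · obtain ⟨h, rfl⟩ := hg
      rw [← Amalgam.base_eq_inr]
      exact ⟨o, hy.base_mul h⟩
    · exact ⟨_, .right g y o hg ho hy⟩
  by_cases ho : o = some true
  · subst ho
    cases hx with
    | right g' y o' hg' ho' hy =>
      rw [← mul_assoc, ← map_mul, ← map_mul]
      exact key _ _ _ ho' hy
  · exact key g x o ho hx

theorem Amalgam.exists_reduced (f₁ : H →* G₁) (f₂ : H →* G₂) (x : Amalgam f₁ f₂) :
    ∃ o, Amalgam.Reduced f₁ f₂ o x := by
  obtain ⟨y, rfl⟩ := QuotientGroup.mk'_surjective _ x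
  induction y using Monoid.Coprod.induction_on' with
  | one => exact ⟨none, by rw [map_one, ← map_one (Amalgam.base f₁ f₂)]; exact .base 1⟩
  | inl_mul g y ih => obtain ⟨o, ho⟩ := ih; rw [map_mul]; exact ho.inl_mul g
  | inr_mul g y ih => obtain ⟨o, ho⟩ := ih; rw [map_mul]; exact ho.inr_mul g

/-- A form of the ping-pong lemma: `E` acts on `X` preserving a strict order, the subgroup `H`
fixes two points `e` and `e'`, the elements of the first factor outside `H` exchange them, and the
elements of the second factor outside `H` move `e'` below `e`. -/
theorem exists_amalgam_mulEquiv (f₁ : H →* G₁) (f₂ : H →* G₂) (φ₁ : G₁ →* E) (φ₂ : G₂ →* E)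
    (j : H →* E) (h₁ : ∀ h, φ₁ (f₁ h) = j h) (h₂ : ∀ h, φ₂ (f₂ h) = j h)
    (hj : Function.Injective j) (hgen : φ₁.range ⊔ φ₂.range = ⊤)
    (act : E → X → X) (act_one : ∀ x, act 1 x = x)
    (act_mul : ∀ g k x, act (g * k) x = act g (act k x))
    (r : X → X → Prop) (trans : ∀ x y z, r x y → r y z → r x z) (irrefl : ∀ x, ¬ r x x)
    (mono : ∀ g x y, r x y → r (act g x) (act g y))
    (e e' : X) (hne : e ≠ e') (hee' : ¬ r e e') (he'e : ¬ r e' e)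
    (hH : ∀ h, act (j h) e = e) (hH' : ∀ h, act (j h) e' = e')
    (hswap : ∀ g, g ∉ f₁.range → act (φ₁ g) e = e')
    (hlt : ∀ g, g ∉ f₂.range → r (act (φ₂ g) e') e) :
    ∃ eq : Amalgam f₁ f₂ ≃* E, ∀ h, eq (Amalgam.base f₁ f₂ h) = j h := by
  let Φ : Amalgam f₁ f₂ →* E := QuotientGroup.lift _ (Monoid.Coprod.lift φ₁ φ₂) (by
    refine Subgroup.normalClosure_le_normal ?_
    rintro _ ⟨h, rfl⟩
    simp [h₁, h₂])
  have Φl : ∀ g, Φ (QuotientGroup.mk' (amalgamKernel f₁ f₂) (Monoid.Coprod.inl g)) = φ₁ g :=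
    fun g => Monoid.Coprod.lift_apply_inl φ₁ φ₂ g
  have Φr : ∀ g, Φ (QuotientGroup.mk' (amalgamKernel f₁ f₂) (Monoid.Coprod.inr g)) = φ₂ g :=
    fun g => Monoid.Coprod.lift_apply_inr φ₁ φ₂ g
  have Φb : ∀ h, Φ (Amalgam.base f₁ f₂ h) = j h := fun h => by
    rw [Amalgam.base_eq_inl, Φl, h₁]
  have hswap' : ∀ g, g ∉ f₁.range → act (φ₁ g) e' = e := by
    intro g hg
    rw [← hswap g⁻¹ (fun h => hg (inv_mem_iff.1 h)), ← act_mul, ← map_mul, mul_inv_cancel, map_one,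
      act_one]
  -- A nonempty reduced word moves `e` or `e'` in a way that the identity cannot. The alternative
  -- `act (Φ x) e = e'` is needed for a single letter of `G₁`, which only exchanges the two points.
  have key : ∀ o x, Amalgam.Reduced f₁ f₂ o x → match o with
      | none => ∃ h, x = Amalgam.base f₁ f₂ h
      | some false => (∃ z ∈ ({e, e'} : Set X), r (act (Φ x) z) e') ∨ act (Φ x) e = e'
      | some true => ∃ z ∈ ({e, e'} : Set X), r (act (Φ x) z) e := by
    intro o x hx
    induction hx with
    | base h => exact ⟨h, rfl⟩
    | left g x o hg ho hx ih =>
      match o, ho, ih with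
      | none, _, ⟨h, hh⟩ => right; rw [map_mul, Φl, act_mul, hh, Φb, hH, hswap g hg]
      | some true, _, ⟨z, hz, hr⟩ =>
        left
        refine ⟨z, hz, ?_⟩
        rw [map_mul, Φl, act_mul, ← hswap g hg]
        exact mono _ _ _ hr
    | right g x o hg ho hx ih =>
      match o, ho, ih with
      | none, _, ⟨h, hh⟩ =>
        refine ⟨e', by simp, ?_⟩
        rw [map_mul, Φr, act_mul, hh, Φb, hH']
        exact hlt g hg
      | some false, _, .inl ⟨z, hz, hr⟩ =>
        refine ⟨z, hz, ?_⟩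
        rw [map_mul, Φr, act_mul]
        exact trans _ _ _ (mono _ _ _ hr) (hlt g hg)
      | some false, _, .inr hr =>
        refine ⟨e, by simp, ?_⟩
        rw [map_mul, Φr, act_mul, hr]
        exact hlt g hg
  -- For `Φ x = 1` each nonempty case contradicts irreflexivity, incomparability of `e` and `e'`, or
  -- `e ≠ e'`; on `H` injectivity is that of `j`.
  have inj : Function.Injective Φ := by
    rw [injective_iff_map_eq_one]
    intro x hx
    obtain ⟨o, ho⟩ := Amalgam.exists_reduced f₁ f₂ x
    have := key o x ho
    match o, this with
    | none, ⟨h, hh⟩ =>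
      subst hh
      rw [Φb, ← map_one j] at hx
      rw [hj hx, map_one]
    | some false, .inl ⟨z, hz, hr⟩ =>
      rw [hx, act_one] at hr
      rcases hz with rfl | rfl
      · exact absurd hr hee'
      · exact absurd hr (irrefl _)
    | some false, .inr hr => rw [hx, act_one] at hr; exact absurd hr hne
    | some true, ⟨z, hz, hr⟩ =>
      rw [hx, act_one] at hr
      rcases hz with rfl | rfl
      · exact absurd hr (irrefl _)
      · exact absurd hr he'e
  have surj : Function.Surjective Φ := by
    rw [← MonoidHom.range_eq_top, eq_top_iff, ← hgen, sup_le_iff]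
    constructor
    · rintro _ ⟨g, rfl⟩; exact ⟨_, Φl g⟩
    · rintro _ ⟨g, rfl⟩; exact ⟨_, Φr g⟩
  exact ⟨MulEquiv.ofBijective Φ ⟨inj, surj⟩, Φb⟩

end PingPong
end

/-! ### Coxeter groups of root families, positivity of roots and parabolic subgroups. -/

noncomputable section

/-- A family of roots of norm `2` in a lattice, whose other products are `0`, `-1` or `-2`. -/
structure RootFamily (B L : Type*) [AddCommGroup L] where
  form : L →ₗ[ℤ] L →ₗ[ℤ] ℤ
  symm : ∀ x y, form x y = form y x
  root : B → L
  norm : ∀ b, form (root b) (root b) = 2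
  gram : ∀ a b, a ≠ b →
    form (root a) (root b) = 0 ∨ form (root a) (root b) = -1 ∨ form (root a) (root b) = -2

namespace RootFamily

variable {B L : Type*} [AddCommGroup L] (R : RootFamily B L)

open scoped Classical in
/-- The Coxeter matrix of a root family. -/
def matrix : CoxeterMatrix B where
  M a b := if a = b then 1 else if R.form (R.root a) (R.root b) = 0 then 2 else
    if R.form (R.root a) (R.root b) = -1 then 3 else 0
  isSymm := by
    refine Matrix.IsSymm.ext fun a b => ?_
    rw [R.symm (R.root b)]
    by_cases h : a = b
    · simp [h]
    · simp [h, Ne.symm h]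
  diagonal a := by simp
  off_diagonal a b h := by
    simp only [h, if_false]
    split_ifs <;> decide

theorem matrix_of_form_eq_zero {a b : B} (h : R.form (R.root a) (R.root b) = 0) :
    R.matrix a b = 2 := by
  have hab : a ≠ b := by
    rintro rfl
    rw [R.norm] at h
    exact absurd h (by decide)
  simp only [matrix]
  rw [if_neg hab, if_pos h]

theorem matrix_of_form_eq_neg_one {a b : B} (h : R.form (R.root a) (R.root b) = -1) :
    R.matrix a b = 3 := by
  have hab : a ≠ b := by
    rintro rfl
    rw [R.norm] at h
    exact absurd h (by decide)
  simp only [matrix]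
  rw [if_neg hab, if_neg (by rw [h]; decide), if_pos h]

theorem matrix_of_form_eq_neg_two {a b : B} (h : R.form (R.root a) (R.root b) = -2) :
    R.matrix a b = 0 := by
  have hab : a ≠ b := by
    rintro rfl
    rw [R.norm] at h
    exact absurd h (by decide)
  simp only [matrix]
  rw [if_neg hab, if_neg (by rw [h]; decide), if_neg (by rw [h]; decide)]

/-- The reflection in a root. -/
def refl (b : B) : L ≃ₗ[ℤ] L := Module.reflection (R.norm b)

theorem refl_apply (b : B) (x : L) : R.refl b x = x - R.form (R.root b) x • R.root b := by
  simp [refl, Module.reflection_apply]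

/-- Products `0` and `-1` of two roots give orders `2` and `3`. For `-2` the Coxeter entry is `0`,
which stands for infinite order, so there is no relation to check. -/
theorem isLiftable_refl : R.matrix.IsLiftable R.refl := by
  intro a b
  by_cases hab : a = b
  · subst hab
    rw [R.matrix.diagonal, pow_one]
    ext x
    simp [LinearEquiv.mul_apply, refl, Module.involutive_reflection (R.norm a) x]
  · rcases R.gram a b hab with h | h | h
    · rw [R.matrix_of_form_eq_zero h]
      ext x
      have h' := h
      rw [R.symm] at h'
      simp only [pow_succ, pow_zero, one_mul, LinearEquiv.mul_apply, refl_apply, map_sub, map_smul,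
        R.norm, h, h', LinearEquiv.coe_one, id_eq]
      module
    · rw [R.matrix_of_form_eq_neg_one h]
      ext x
      have h' := h
      rw [R.symm] at h'
      simp only [pow_succ, pow_zero, one_mul, LinearEquiv.mul_apply, refl_apply, map_sub, map_smul,
        R.norm, h, h', LinearEquiv.coe_one, id_eq]
      module
    · rw [R.matrix_of_form_eq_neg_two h, pow_zero]

/-- The Coxeter group of a root family. -/
abbrev Weyl : Type _ := R.matrix.Group

/-- The Coxeter system of a root family. -/
def cox : CoxeterSystem R.matrix R.Weyl := R.matrix.toCoxeterSystem

/-- The action of the Coxeter group by reflections. -/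
def rep : R.Weyl →* (L ≃ₗ[ℤ] L) := R.cox.lift ⟨R.refl, R.isLiftable_refl⟩

@[simp] theorem rep_simple (b : B) : R.rep (R.cox.simple b) = R.refl b :=
  R.cox.lift_apply_simple R.isLiftable_refl b

theorem rep_mul_simple_apply (w : R.Weyl) (b : B) (x : L) :
    R.rep (w * R.cox.simple b) x = R.rep w x - R.form (R.root b) x • R.rep w (R.root b) := by
  rw [map_mul, rep_simple, LinearEquiv.mul_apply, refl_apply, map_sub, map_smul]

theorem form_refl (b : B) (x y : L) : R.form (R.refl b x) (R.refl b y) = R.form x y := by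
  simp only [refl_apply, map_sub, map_smul, LinearMap.sub_apply, LinearMap.smul_apply, R.norm,
    smul_eq_mul, R.symm x (R.root b)]
  ring

theorem form_rep (w : R.Weyl) (x y : L) : R.form (R.rep w x) (R.rep w y) = R.form x y := by
  induction w using R.cox.simple_induction_right generalizing x y with
  | one => simp
  | mul_simple_right w b ih =>
    rw [map_mul, rep_simple, LinearEquiv.mul_apply, LinearEquiv.mul_apply, ih,
      form_refl]

/-- The nonnegative combinations of the roots of the family. -/
def positive : AddSubmonoid L := AddSubmonoid.closure (Set.range R.root)

theorem root_mem_positive (b : B) : R.root b ∈ R.positive := AddSubmonoid.subset_closure ⟨b, rfl⟩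

theorem simple_mul_simple_of_form_eq_zero {a b : B} (h : R.form (R.root a) (R.root b) = 0)
    (w : R.Weyl) : w * R.cox.simple a * R.cox.simple b * R.cox.simple a = w * R.cox.simple b := by
  have := R.cox.simple_mul_simple_pow a b
  rw [R.matrix_of_form_eq_zero h, pow_two] at this
  have h2 : R.cox.simple a * R.cox.simple b * R.cox.simple a = R.cox.simple b := by
    rw [← mul_left_inj (R.cox.simple b)]
    simpa [mul_assoc] using this
  simp only [mul_assoc] at h2 ⊢
  rw [h2]

theorem simple_braid_of_form_eq_neg_one {a b : B} (h : R.form (R.root a) (R.root b) = -1)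
    (w : R.Weyl) : w * R.cox.simple b * R.cox.simple a * R.cox.simple b * R.cox.simple a =
      w * R.cox.simple a * R.cox.simple b := by
  have := R.cox.simple_mul_simple_pow a b
  rw [R.matrix_of_form_eq_neg_one h, pow_succ, pow_two] at this
  have h2 : R.cox.simple b * (R.cox.simple a * (R.cox.simple b * R.cox.simple a)) =
      R.cox.simple a * R.cox.simple b := by
    rw [← mul_right_inj (R.cox.simple a), ← mul_left_inj (R.cox.simple b)]
    simpa [mul_assoc] using this
  simp only [mul_assoc]
  rw [h2]

/-- A simple root is mapped to a positive root by the elements that it does not shorten. -/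
theorem rep_root_mem_positive (w : R.Weyl) (b : B)
    (h : R.cox.length w < R.cox.length (w * R.cox.simple b)) :
    R.rep w (R.root b) ∈ R.positive := by
  induction hn : R.cox.length w using Nat.strong_induction_on generalizing w b with
  | _ n ih =>
  by_cases hw : w = 1
  · rw [hw, map_one]; exact R.root_mem_positive b
  obtain ⟨t, ht⟩ := R.cox.exists_rightDescent_of_ne_one hw
  have ht' : R.cox.length (w * R.cox.simple t) < R.cox.length w := ht
  obtain ⟨v, rfl⟩ : ∃ v, w = v * R.cox.simple t := ⟨w * R.cox.simple t, by simp⟩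
  rw [R.cox.simple_mul_simple_cancel_right] at ht'
  have hvl := R.cox.length_mul_simple v t
  have hbt : t ≠ b := by
    rintro rfl
    rw [R.cox.simple_mul_simple_cancel_right] at h
    lia
  have hvt : R.rep v (R.root t) ∈ R.positive := ih _ (by lia) v t ht' rfl
  rw [rep_mul_simple_apply]
  -- Now `w = v t`, so `w` maps the root of `b` to that of `v` plus `0`, `1` or `2` times the image
  -- under `v` of the root of `t`. If `b` lengthens `v`, all terms are positive by induction;
  -- otherwise the rank-two relation between `b` and `t` decides.
  by_cases hb : R.cox.length v < R.cox.length (v * R.cox.simple b)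
  · have hvb : R.rep v (R.root b) ∈ R.positive := ih _ (by lia) v b hb rfl
    rcases R.gram t b hbt with hg | hg | hg <;> rw [hg]
    · simpa using hvb
    · simpa using add_mem hvb hvt
    · convert add_mem hvb (add_mem hvt hvt) using 1
      module
  obtain ⟨u, rfl⟩ : ∃ u, v = u * R.cox.simple b := ⟨v * R.cox.simple b, by simp⟩
  rw [R.cox.simple_mul_simple_cancel_right] at hb
  have hul := R.cox.length_mul_simple u b
  rcases R.gram t b hbt with hg | hg | hg
  · have hg' := hg
    rw [R.symm] at hg'
    -- Here `w = u b t` and `w b = u t`, which is too short for `b` to lengthen `w`.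
    rw [R.simple_mul_simple_of_form_eq_zero hg'] at h
    have := R.cox.length_mul_simple u t
    lia
  · have hg' := hg
    rw [R.symm] at hg'
    by_cases hut : R.cox.length u < R.cox.length (u * R.cox.simple t)
    -- Since `s_b s_t` maps the root of `b` to the root of `t`, the vector in question is the image
    -- of the latter under `u`.
    · have := ih _ (by lia) u t hut rfl
      rw [rep_mul_simple_apply, rep_mul_simple_apply, hg', hg, R.norm]
      convert this using 1
      module
    · obtain ⟨x, rfl⟩ : ∃ x, u = x * R.cox.simple t := ⟨u * R.cox.simple t, by simp⟩
      rw [R.cox.simple_mul_simple_cancel_right] at hut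
      -- Here `w = x t b t`, and the braid relation gives `w b = x b t`, again too short.
      rw [R.simple_braid_of_form_eq_neg_one hg'] at h
      have h1 := R.cox.length_mul_simple x t
      have h2 := R.cox.length_mul_simple x b
      have h3 := R.cox.length_mul_simple (x * R.cox.simple b) t
      lia
  · have hg' := hg
    rw [R.symm] at hg'
    -- The sum of the two roots is orthogonal to both, hence fixed by `s_b` and `s_t`. So `y` may be
    -- shortened by `b` or `t` until neither shortens it, and then the induction hypothesis makes
    -- both summands positive.
    have key : ∀ m, ∀ y : R.Weyl, R.cox.length y = m → R.cox.length y < n →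
        R.rep y (R.root b + R.root t) ∈ R.positive := by
      intro m
      induction m using Nat.strong_induction_on with
      | _ m ihm =>
      intro y hy hyn
      by_cases hyb : R.cox.length y < R.cox.length (y * R.cox.simple b)
      · by_cases hyt : R.cox.length y < R.cox.length (y * R.cox.simple t)
        · rw [map_add]
          exact add_mem (ih _ hyn y b hyb rfl) (ih _ hyn y t hyt rfl)
        · have h1 := R.cox.length_mul_simple y t
          have := ihm _ (by lia) (y * R.cox.simple t) rfl (by lia)
          rw [rep_mul_simple_apply, map_add (R.form _), hg, R.norm] at this
          simpa using this
      · have h1 := R.cox.length_mul_simple y b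
        have := ihm _ (by lia) (y * R.cox.simple b) rfl (by lia)
        rw [rep_mul_simple_apply, map_add (R.form _), hg', R.norm] at this
        simpa using this
    -- The image of the root of `b` under `w` is `v (root b) + 2 v (root t)`, regrouped as `v (root
    -- t) + v (root b + root t)` because `v (root b)` alone is not known to be positive.
    have h2 := add_mem hvt (key _ _ rfl (by lia : R.cox.length (u * R.cox.simple b) < n))
    rw [hg]
    convert h2 using 1
    rw [map_add]
    module

/-- Let `v` be orthogonal to all simple roots but `root t`, with which it has product `2`. An
element of the Coxeter group is in the parabolic subgroup that fixes `v`, or moves `v` by a sum of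
positive roots that has product at least `4` with `v`. -/
theorem mem_parabolic_or (v : L) (t : B) (ht : R.form v (R.root t) = 2)
    (hb : ∀ b, b ≠ t → R.form v (R.root b) = 0) (w : R.Weyl) :
    w ∈ Subgroup.closure (R.cox.simple '' {b | b ≠ t}) ∨
      ∃ x ∈ R.positive, R.rep w v = v - x ∧ 4 ≤ R.form v x := by
  have hpos : ∀ x ∈ R.positive, 0 ≤ R.form v x := by
    intro x hx
    induction hx using AddSubmonoid.closure_induction with
    | mem x hx =>
      obtain ⟨b, rfl⟩ := hx
      by_cases h : b = t
      · rw [h, ht]; decide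
      · rw [hb b h]
    | zero => simp
    | add x y _ _ hx hy => rw [map_add]; exact add_nonneg hx hy
  have hfix : ∀ b, b ≠ t → R.refl b v = v := by
    intro b h
    rw [refl_apply, R.symm, hb b h, zero_smul, sub_zero]
  have hpar : ∀ w ∈ Subgroup.closure (R.cox.simple '' {b | b ≠ t}), R.rep w v = v := by
    intro w hw
    induction hw using Subgroup.closure_induction with
    | mem x hx =>
      obtain ⟨b, hb, rfl⟩ := hx
      rw [rep_simple, hfix b hb]
    | one => simp
    | mul x y _ _ hx hy => rw [map_mul, LinearEquiv.mul_apply, hy, hx]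
    | inv x _ hx =>
      nth_rewrite 1 [← hx]
      rw [← LinearEquiv.mul_apply, ← map_mul, inv_mul_cancel, map_one, LinearEquiv.coe_one, id_eq]
  induction hn : R.cox.length w using Nat.strong_induction_on generalizing w with
  | _ n ih =>
  by_cases hw : w = 1
  · left; rw [hw]; exact one_mem _
  obtain ⟨b, hd⟩ := R.cox.exists_rightDescent_of_ne_one hw
  have hd' : R.cox.length (w * R.cox.simple b) < R.cox.length w := hd
  obtain ⟨u, rfl⟩ : ∃ u, w = u * R.cox.simple b := ⟨w * R.cox.simple b, by simp⟩
  rw [R.cox.simple_mul_simple_cancel_right] at hd'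
  have ihu := ih _ (by lia) u rfl
  by_cases hbt : b = t
  · subst hbt
    right
    have hu := R.rep_root_mem_positive u b hd'
    rw [rep_mul_simple_apply, R.symm, ht]
    rcases ihu with hu' | ⟨x, hx, hux, hx4⟩
    -- The first time `t` is used, `v` moves by twice a root that has product `2` with `v`, whence
    -- the bound `4`. Later steps add only vectors of nonnegative product.
    · refine ⟨R.rep u (R.root b) + R.rep u (R.root b), add_mem hu hu, by rw [hpar u hu']; module,
        ?_⟩
      have : R.form v (R.rep u (R.root b)) = 2 := by
        nth_rewrite 1 [← hpar u hu']
        rw [form_rep, ht]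
      rw [map_add, this]; decide
    · refine ⟨x + (R.rep u (R.root b) + R.rep u (R.root b)), add_mem hx (add_mem hu hu),
        by rw [hux]; module, ?_⟩
      have := hpos _ hu
      rw [map_add, map_add]
      lia
  · rcases ihu with hu' | ⟨x, hx, hux, hx4⟩
    · left
      exact mul_mem hu' (Subgroup.subset_closure ⟨b, hbt, rfl⟩)
    · right
      refine ⟨x, hx, ?_, hx4⟩
      rw [rep_mul_simple_apply, R.symm, hb b hbt, zero_smul, sub_zero, hux]

end RootFamily
end

/-! ### Clifford algebra computations and the scalar matrices in the elementary group. -/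

noncomputable section

theorem cliffForm_apply (n : ℕ) (v : Fin (n - 1) → ℝ) : cliffForm n v = -∑ i, v i * v i := by
  simp [cliffForm, QuadraticMap.weightedSumSquares_apply]

theorem polar_cliffForm (n : ℕ) (v w : Fin (n - 1) → ℝ) :
    QuadraticMap.polar (cliffForm n) v w = -2 * ∑ i, v i * w i := by
  simp only [QuadraticMap.polar, cliffForm_apply, Pi.add_apply, Finset.mul_sum,
    ← Finset.sum_neg_distrib, ← Finset.sum_sub_distrib]
  refine Finset.sum_congr rfl fun i _ => ?_
  ring

theorem cliffGen_mul_self (n : ℕ) (k : Fin (n - 1)) : cliffGen n k * cliffGen n k = -1 := by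
  rw [cliffGen, CliffordAlgebra.ι_sq_scalar, cliffForm_apply]
  simp [Pi.single_apply]

theorem cliffGen_anticomm (n : ℕ) {k l : Fin (n - 1)} (h : k ≠ l) :
    cliffGen n k * cliffGen n l = -(cliffGen n l * cliffGen n k) := by
  rw [eq_neg_iff_add_eq_zero, cliffGen, cliffGen, CliffordAlgebra.ι_mul_ι_add_swap, polar_cliffForm]
  simp [Pi.single_apply, h.symm]

theorem involute_cliffGen (n : ℕ) (k : Fin (n - 1)) :
    CliffordAlgebra.involute (cliffGen n k) = -cliffGen n k :=
  CliffordAlgebra.involute_ι _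

theorem ι_eq_sum_cliffGen (n : ℕ) (v : Fin (n - 1) → ℝ) :
    CliffordAlgebra.ι (cliffForm n) v = ∑ k, v k • cliffGen n k := by
  simp only [cliffGen, ← map_smul, ← map_sum]
  congr 1
  ext i
  simp [Finset.sum_apply, Pi.single_apply]

theorem adjoin_range_cliffGen (n : ℕ) : Algebra.adjoin ℝ (Set.range (cliffGen n)) = ⊤ := by
  rw [eq_top_iff, ← CliffordAlgebra.adjoin_range_ι, Algebra.adjoin_le_iff]
  rintro _ ⟨v, rfl⟩
  rw [ι_eq_sum_cliffGen]
  exact sum_mem fun k _ => Subalgebra.smul_mem _ (Algebra.subset_adjoin (Set.mem_range_self k)) _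

theorem cliffGen_mul_of_mem_adjoin (n : ℕ) {S : Set (Fin (n - 1))} {k : Fin (n - 1)} (hk : k ∉ S)
    {u : Cliff n} (hu : u ∈ Algebra.adjoin ℝ (cliffGen n '' S)) :
    cliffGen n k * u = CliffordAlgebra.involute u * cliffGen n k := by
  induction hu using Algebra.adjoin_induction with
  | mem x hx =>
    obtain ⟨l, hl, rfl⟩ := hx
    rw [involute_cliffGen, neg_mul, cliffGen_anticomm]
    rintro rfl
    exact hk hl
  | algebraMap r => rw [AlgHom.commutes, Algebra.commutes]
  | add x y _ _ hx hy => rw [mul_add, hx, hy, map_add, add_mul]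
  | mul x y _ _ hx hy => rw [← mul_assoc, hx, mul_assoc, hy, map_mul, mul_assoc]

theorem involute_mem_adjoin (n : ℕ) {S : Set (Fin (n - 1))} {u : Cliff n}
    (hu : u ∈ Algebra.adjoin ℝ (cliffGen n '' S)) :
    CliffordAlgebra.involute u ∈ Algebra.adjoin ℝ (cliffGen n '' S) := by
  induction hu using Algebra.adjoin_induction with
  | mem x hx =>
    obtain ⟨l, hl, rfl⟩ := hx
    rw [involute_cliffGen]
    exact neg_mem (Algebra.subset_adjoin ⟨l, hl, rfl⟩)
  | algebraMap r => rw [AlgHom.commutes]; exact Subalgebra.algebraMap_mem _ r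
  | add x y _ _ hx hy => rw [map_add]; exact add_mem hx hy
  | mul x y _ _ hx hy => rw [map_mul]; exact mul_mem hx hy

/-- Expressions `u + v iₖ` are closed under products because `iₖ² = -1` and `iₖ` passes through the
smaller subalgebra at the cost of the main involution. -/
theorem exists_of_mem_adjoin_insert (n : ℕ) {S : Set (Fin (n - 1))} {k : Fin (n - 1)} (hk : k ∉ S)
    {p : Cliff n} (hp : p ∈ Algebra.adjoin ℝ (cliffGen n '' insert k S)) :
    ∃ u ∈ Algebra.adjoin ℝ (cliffGen n '' S), ∃ v ∈ Algebra.adjoin ℝ (cliffGen n '' S),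
      p = u + v * cliffGen n k := by
  induction hp using Algebra.adjoin_induction with
  | mem x hx =>
    obtain ⟨l, rfl | hl, rfl⟩ := hx
    · exact ⟨0, zero_mem _, 1, one_mem _, by simp⟩
    · exact ⟨_, Algebra.subset_adjoin ⟨l, hl, rfl⟩, 0, zero_mem _, by simp⟩
  | algebraMap r => exact ⟨_, Subalgebra.algebraMap_mem _ r, 0, zero_mem _, by simp⟩
  | add x y _ _ hx hy =>
    obtain ⟨u, hu, v, hv, rfl⟩ := hx
    obtain ⟨u', hu', v', hv', rfl⟩ := hy
    exact ⟨_, add_mem hu hu', _, add_mem hv hv', by rw [add_mul]; abel⟩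
  | mul x y _ _ hx hy =>
    obtain ⟨u, hu, v, hv, rfl⟩ := hx
    obtain ⟨u', hu', v', hv', rfl⟩ := hy
    refine ⟨u * u' - v * CliffordAlgebra.involute v',
      sub_mem (mul_mem hu hu') (mul_mem hv (involute_mem_adjoin n hv')),
      u * v' + v * CliffordAlgebra.involute u',
      add_mem (mul_mem hu hv') (mul_mem hv (involute_mem_adjoin n hu')), ?_⟩
    have h1 := cliffGen_mul_of_mem_adjoin n hk hu'
    have h2 := cliffGen_mul_of_mem_adjoin n hk hv'
    have h3 := cliffGen_mul_self n k
    calc (u + v * cliffGen n k) * (u' + v' * cliffGen n k)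
        = u * u' + u * v' * cliffGen n k + v * (cliffGen n k * u')
          + v * (cliffGen n k * v') * cliffGen n k := by noncomm_ring
      _ = u * u' + u * v' * cliffGen n k + v * CliffordAlgebra.involute u' * cliffGen n k
          + v * CliffordAlgebra.involute v' * (cliffGen n k * cliffGen n k) := by
        rw [h1, h2]; noncomm_ring
      _ = _ := by rw [h3]; noncomm_ring

/-- An even element that commutes with the generators is a scalar. -/
theorem exists_algebraMap_of_even_of_commute (n : ℕ) (p : Cliff n)
    (hev : CliffordAlgebra.involute p = p) (hc : ∀ k, cliffGen n k * p = p * cliffGen n k) :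
    ∃ r : ℝ, p = algebraMap ℝ (Cliff n) r := by
  -- The generators are eliminated one at a time. If `p = u + v iₖ` is even and commutes with `iₖ`,
  -- comparing `iₖ p` with `p iₖ` forces `v = 0`.
  have key : ∀ S : Finset (Fin (n - 1)), p ∈ Algebra.adjoin ℝ (cliffGen n '' S) →
      p ∈ (⊥ : Subalgebra ℝ (Cliff n)) := by
    intro S
    induction S using Finset.induction_on with
    | empty => intro h; simpa using h
    | insert k S hk ih =>
      intro h
      rw [Finset.coe_insert] at h
      obtain ⟨u, hu, v, hv, huv⟩ := exists_of_mem_adjoin_insert n (by simpa using hk) h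
      refine ih ?_
      have hu' := involute_mem_adjoin n hu
      have hv' := involute_mem_adjoin n hv
      set g := cliffGen n k with hg
      have hk' : k ∉ (S : Set (Fin (n - 1))) := by simpa using hk
      have e1 : p = CliffordAlgebra.involute u - CliffordAlgebra.involute v * g := by
        rw [← hev, huv, map_add, map_mul, involute_cliffGen]; noncomm_ring
      have gg : g * g = -1 := cliffGen_mul_self n k
      have e2 : g * p = CliffordAlgebra.involute u * g - CliffordAlgebra.involute v := by
        rw [huv, mul_add, ← mul_assoc, cliffGen_mul_of_mem_adjoin n hk' hu,
          cliffGen_mul_of_mem_adjoin n hk' hv, mul_assoc, ← hg, gg]; noncomm_ring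
      have e3 : p * g = CliffordAlgebra.involute u * g + CliffordAlgebra.involute v := by
        rw [e1, sub_mul, mul_assoc, gg]; noncomm_ring
      have e4 : (2 : ℝ) • CliffordAlgebra.involute v = 0 := by
        have := hc k
        rw [← hg, e2, e3, sub_eq_add_neg, add_right_inj, neg_eq_iff_add_eq_zero] at this
        rw [two_smul]; exact this
      have e5 : CliffordAlgebra.involute v = 0 :=
        (smul_eq_zero.1 e4).resolve_left (by norm_num)
      rw [e1, e5, zero_mul, sub_zero]
      exact hu'
  have := key Finset.univ (by
    rw [Finset.coe_univ, Set.image_univ, adjoin_range_cliffGen]; exact Algebra.mem_top)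
  obtain ⟨r, hr⟩ := Algebra.mem_bot.1 this
  exact ⟨r, hr.symm⟩

/-- The entrywise main involution on invertible matrices. -/
def matInvolute (n : ℕ) :
    (Matrix (Fin 2) (Fin 2) (Cliff n))ˣ →* (Matrix (Fin 2) (Fin 2) (Cliff n))ˣ :=
  Units.map ((CliffordAlgebra.involute (Q := cliffForm n)).toRingHom.mapMatrix :
    _ →+* Matrix (Fin 2) (Fin 2) (Cliff n))

theorem star_cliffGen (n : ℕ) (k : Fin (n - 1)) : star (cliffGen n k) = -cliffGen n k :=
  CliffordAlgebra.star_ι _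

theorem involute_eq_star_of_mem_cliffVec {n : ℕ} {x : Cliff n} (hx : x ∈ cliffVec n) :
    CliffordAlgebra.involute x = star x := by
  induction hx using Submodule.span_induction with
  | mem x hx =>
    rcases hx with rfl | ⟨k, rfl⟩
    · simp
    · rw [involute_cliffGen, star_cliffGen]
  | zero => simp
  | add x y _ _ hx hy => rw [map_add, star_add, hx, hy]
  | smul a x _ hx => rw [map_zsmul, hx, star_zsmul]

/-- This is the analogue of `gᵀ J g = J` for determinant one. It is needed because commuting with
all generators does not make an element scalar when the product of all generators is central; for
unitary `g` the identity supplies the missing evenness. -/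
theorem star_mul_elemMat_zero_mul_matInvolute {n : ℕ} {g : (Matrix (Fin 2) (Fin 2) (Cliff n))ˣ}
    (hg : g ∈ E2Γ n) : star g * elemMat 0 * matInvolute n g = elemMat 0 := by
  induction hg using Subgroup.closure_induction with
  | mem x hx =>
    obtain ⟨x, hx, rfl⟩ := hx
    have := involute_eq_star_of_mem_cliffVec hx
    ext i j
    fin_cases i <;> fin_cases j <;>
      simp [matInvolute, elemMat, Matrix.mul_apply, Fin.sum_univ_two, Matrix.star_eq_conjTranspose,
        this]
  | one => simp
  | mul x y _ _ hx hy =>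
    rw [star_mul, map_mul]
    calc star y * star x * elemMat 0 * (matInvolute n x * matInvolute n y)
        = star y * (star x * elemMat 0 * matInvolute n x) * matInvolute n y := by
          simp only [mul_assoc]
      _ = _ := by rw [hx, hy]
  | inv x _ hx =>
    nth_rewrite 1 [← hx]
    rw [star_inv, map_inv]
    group

/-- An element of the elementary group that commutes with the hermitian matrices over `Vⁿ(ℤ)` and
is unitary is `1` or `-1`. -/
theorem eq_one_or_eq_neg_one {n : ℕ} {g : (Matrix (Fin 2) (Fin 2) (Cliff n))ˣ} (hg : g ∈ E2Γ n)
    (h1 : g.val * star g.val = 1)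
    (ha : g.val * !![1, 0; 0, 0] = !![1, 0; 0, 0] * g.val)
    (hb : g.val * !![0, 1; 1, 0] = !![0, 1; 1, 0] * g.val)
    (hc : ∀ k, g.val * !![0, cliffGen n k; -cliffGen n k, 0] =
      !![0, cliffGen n k; -cliffGen n k, 0] * g.val) : g = 1 ∨ g = -1 := by
  have h01 : g.val 0 1 = 0 := by
    have := congrFun (congrFun ha 0) 1
    simpa [Matrix.mul_apply, Fin.sum_univ_two] using this.symm
  have h10 : g.val 1 0 = 0 := by
    have := congrFun (congrFun ha 1) 0
    simpa [Matrix.mul_apply, Fin.sum_univ_two] using this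
  have h11 : g.val 1 1 = g.val 0 0 := by
    have := congrFun (congrFun hb 0) 1
    simpa [Matrix.mul_apply, Fin.sum_univ_two] using this.symm
  have hcomm : ∀ k, cliffGen n k * g.val 0 0 = g.val 0 0 * cliffGen n k := by
    intro k
    have := congrFun (congrFun (hc k) 0) 1
    simpa [Matrix.mul_apply, Fin.sum_univ_two, h11] using this.symm
  have hsu : star g * g = 1 := by
    have : g * star g = 1 := Units.ext h1
    rw [← inv_eq_of_mul_eq_one_right this, inv_mul_cancel]
  have hev : CliffordAlgebra.involute (g.val 0 0) = g.val 0 0 := by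
    have h2 : elemMat 0 * matInvolute n g = g * elemMat 0 := by
      have := star_mul_elemMat_zero_mul_matInvolute hg
      rw [mul_assoc] at this
      rw [← mul_right_inj (star g), this, ← mul_assoc, hsu, one_mul]
    have h3 : (elemMat 0 * matInvolute n g).val = (g * elemMat 0).val := by rw [h2]
    have := congrFun (congrFun h3 1) 0
    simpa [matInvolute, elemMat, Matrix.mul_apply, Fin.sum_univ_two, h11] using this
  obtain ⟨r, hr⟩ := exists_algebraMap_of_even_of_commute n _ hev hcomm
  have hrr : r * r = 1 := by
    have := congrFun (congrFun h1 0) 0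
    simp only [Matrix.mul_apply, Fin.sum_univ_two, h01, hr, Matrix.star_apply, zero_mul, add_zero,
      CliffordAlgebra.star_algebraMap, ← map_mul, Matrix.one_apply_eq] at this
    exact (algebraMap ℝ (Cliff n)).injective (by rw [this, map_one])
  have hval : ∀ i j, g.val i j = algebraMap ℝ (Cliff n) (if i = j then r else 0) := by
    intro i j
    fin_cases i <;> fin_cases j <;> simp [h01, h10, h11, hr]
  rcases mul_self_eq_one_iff.1 hrr with rfl | rfl
  · left
    ext i j
    rw [hval]
    fin_cases i <;> fin_cases j <;> simp
  · right
    ext i j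
    rw [hval]
    fin_cases i <;> fin_cases j <;> simp
end

/-! ### The lattice of hermitian matrices, its Lorentzian form and its simple roots. -/

noncomputable section

/-- The scalar and the vector have opposite parity, so the main involution separates them; the
vector then vanishes because the form is definite. -/
theorem algebraMap_add_ι_eq_zero {n : ℕ} {r : ℝ} {v : Fin (n - 1) → ℝ}
    (h : algebraMap ℝ (Cliff n) r + CliffordAlgebra.ι (cliffForm n) v = 0) : r = 0 ∧ v = 0 := by
  have h' := congrArg CliffordAlgebra.involute h
  rw [map_add, AlgHom.commutes, CliffordAlgebra.involute_ι, map_zero] at h'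
  have hr : r = 0 := by
    have h2 : algebraMap ℝ (Cliff n) (r + r) = 0 := by
      rw [map_add]
      refine Eq.trans ?_ ((congrArg₂ (· + ·) h h').trans (add_zero 0))
      abel
    have := (map_eq_zero_iff _ (algebraMap ℝ (Cliff n)).injective).1 h2
    linarith
  refine ⟨hr, ?_⟩
  rw [hr, map_zero, zero_add] at h
  have h2 := CliffordAlgebra.ι_sq_scalar (cliffForm n) v
  rw [h, mul_zero, eq_comm, map_eq_zero_iff _ (algebraMap ℝ (Cliff n)).injective, cliffForm_apply,
    neg_eq_zero, Finset.sum_eq_zero_iff_of_nonneg fun i _ => mul_self_nonneg _] at h2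
  ext i
  exact mul_self_eq_zero.1 (h2 i (Finset.mem_univ i))

/-- The element `b₀ + b₁ i₁ + ⋯ + bₘ iₘ` of `Vᵐ⁺¹(ℤ)`. -/
def paravec (m : ℕ) (b : Fin (m + 1) → ℤ) : Cliff (m + 1) :=
  algebraMap ℝ _ (b 0) + CliffordAlgebra.ι (cliffForm (m + 1)) fun k : Fin m => (b k.succ : ℝ)

theorem paravec_add (m : ℕ) (b c : Fin (m + 1) → ℤ) :
    paravec m (b + c) = paravec m b + paravec m c := by
  have : (fun k : Fin m => (((b + c) k.succ : ℤ) : ℝ)) =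
      (fun k : Fin m => (b k.succ : ℝ)) + fun k : Fin m => (c k.succ : ℝ) := by
    ext k; simp
  simp only [paravec]
  rw [this]
  erw [map_add]
  simp only [Pi.add_apply, Int.cast_add, map_add]
  abel

theorem paravec_injective (m : ℕ) : Function.Injective (paravec m) := by
  have h0 : ∀ b, paravec m b = 0 → b = 0 := by
    intro b hb
    obtain ⟨h1, h2⟩ := algebraMap_add_ι_eq_zero hb
    ext i
    refine Fin.cases ?_ (fun k => ?_) i
    · exact_mod_cast h1
    · exact Int.cast_eq_zero.1 (congrFun h2 k)
  exact (injective_iff_map_eq_zero (AddMonoidHom.mk' (paravec m) (paravec_add m))).2 h0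

/-- The unit vectors of `Vᵐ⁺¹(ℤ)`. -/
def paraUnit (m : ℕ) (j : Fin (m + 1)) : Cliff (m + 1) := Fin.cases 1 (cliffGen (m + 1)) j

@[simp] theorem paraUnit_zero (m : ℕ) : paraUnit m 0 = 1 := rfl

@[simp] theorem paraUnit_succ (m : ℕ) (k : Fin m) : paraUnit m k.succ = cliffGen (m + 1) k := rfl

theorem paravec_single (m : ℕ) (j : Fin (m + 1)) : paravec m (Pi.single j 1) = paraUnit m j := by
  refine Fin.cases ?_ (fun k => ?_) j
  · have : (fun k : Fin m => (((Pi.single 0 1 : Fin (m + 1) → ℤ) k.succ : ℤ) : ℝ)) = 0 := by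
      ext k; simp
    simp only [paravec]
    rw [this]
    erw [map_zero]
    simp
  · have : (fun l : Fin m => (((Pi.single k.succ 1 : Fin (m + 1) → ℤ) l.succ : ℤ) : ℝ)) =
        Pi.single k 1 := by
      ext l; simp [Pi.single_apply]
    simp only [paravec]
    rw [this]
    simp [cliffGen]

/-- The lattice of hermitian `2 × 2` matrices over `Vᵐ⁺¹(ℤ)`; the entries of a triple are the
diagonal entries and the coordinates of the upper right entry. -/
abbrev HermLattice (m : ℕ) : Type := ℤ × ℤ × (Fin (m + 1) → ℤ)

/-- The hermitian matrix given by a triple. -/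
def hermMat (m : ℕ) : HermLattice m →+ Matrix (Fin 2) (Fin 2) (Cliff (m + 1)) :=
  AddMonoidHom.mk' (fun X => !![(X.1 : Cliff (m + 1)), paravec m X.2.2;
    star (paravec m X.2.2), (X.2.1 : Cliff (m + 1))]) fun X Y => by
      ext i j
      fin_cases i <;> fin_cases j <;> simp [paravec_add]

theorem hermMat_apply (m : ℕ) (X : HermLattice m) : hermMat m X =
    !![(X.1 : Cliff (m + 1)), paravec m X.2.2; star (paravec m X.2.2), (X.2.1 : Cliff (m + 1))] :=
  rfl

theorem hermMat_injective (m : ℕ) : Function.Injective (hermMat m) := by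
  have hc : ∀ a b : ℤ, (a : Cliff (m + 1)) = b → a = b := by
    intro a b h
    have : algebraMap ℝ (Cliff (m + 1)) a = algebraMap ℝ (Cliff (m + 1)) b := by simpa using h
    exact_mod_cast (algebraMap ℝ (Cliff (m + 1))).injective this
  intro X Y h
  rw [hermMat_apply, hermMat_apply] at h
  refine Prod.ext ?_ (Prod.ext ?_ ?_)
  · exact hc _ _ (congrFun (congrFun h 0) 0)
  · exact hc _ _ (congrFun (congrFun h 1) 1)
  · exact paravec_injective m (congrFun (congrFun h 0) 1)

/-- The Lorentzian form on hermitian matrices: `-2` times the determinant, polarized. -/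
def hermForm (m : ℕ) : HermLattice m →ₗ[ℤ] HermLattice m →ₗ[ℤ] ℤ :=
  LinearMap.mk₂ ℤ (fun X Y => 2 * ∑ j, X.2.2 j * Y.2.2 j - X.1 * Y.2.1 - X.2.1 * Y.1)
    (fun X Y Z => by simp [add_mul, Finset.sum_add_distrib]; ring)
    (fun c X Y => by simp only [Prod.smul_fst, Prod.smul_snd, Pi.smul_apply, smul_eq_mul, mul_assoc,
      ← Finset.mul_sum]; ring)
    (fun X Y Z => by simp [mul_add, Finset.sum_add_distrib]; ring)
    (fun c X Y => by simp only [Prod.smul_fst, Prod.smul_snd, Pi.smul_apply, smul_eq_mul,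
      mul_left_comm _ c, ← Finset.mul_sum]; ring)

theorem hermForm_apply (m : ℕ) (X Y : HermLattice m) :
    hermForm m X Y = 2 * ∑ j, X.2.2 j * Y.2.2 j - X.1 * Y.2.1 - X.2.1 * Y.1 := rfl

/-- The simple roots: `none` is the wall `|x|² + t² = 1`, `inl j` the wall `xⱼ = 0` and `inr j` the
wall `xⱼ = 1/2` of upper half-space. -/
def hermRoot (m : ℕ) : Option (Fin (m + 1) ⊕ Fin (m + 1)) → HermLattice m
  | none => (-1, 1, 0)
  | some (.inl j) => (0, 0, Pi.single j 1)
  | some (.inr j) => (1, 0, -Pi.single j 1)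

/-- The root family of the hermitian matrices. -/
def hermRoots (m : ℕ) : RootFamily (Option (Fin (m + 1) ⊕ Fin (m + 1))) (HermLattice m) where
  form := hermForm m
  symm X Y := by
    simp only [hermForm_apply, mul_comm (X.2.2 _)]
    ring
  root := hermRoot m
  norm b := by
    rcases b with _ | j | j <;> simp [hermForm_apply, hermRoot, Pi.single_apply]
  gram a b h := by
    rcases a with _ | j | j <;> rcases b with _ | k | k <;>
      simp [hermForm_apply, hermRoot, Pi.single_apply] at h ⊢
    all_goals split_ifs <;> simp_all

theorem hermRoots_refl_none (m : ℕ) (X : HermLattice m) :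
    (hermRoots m).refl none X = (X.2.1, X.1, X.2.2) := by
  rw [RootFamily.refl_apply]
  simp only [hermRoots, hermForm_apply, hermRoot]
  refine Prod.ext ?_ (Prod.ext ?_ ?_) <;> simp

theorem hermRoots_refl_inl (m : ℕ) (j : Fin (m + 1)) (X : HermLattice m) :
    (hermRoots m).refl (some (.inl j)) X = (X.1, X.2.1, X.2.2 - Pi.single j (2 * X.2.2 j)) := by
  rw [RootFamily.refl_apply]
  simp only [hermRoots, hermForm_apply, hermRoot]
  refine Prod.ext ?_ (Prod.ext ?_ ?_) <;> simp [Pi.single_apply]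
  ext k
  simp [Pi.single_apply]

theorem hermRoots_refl_inr (m : ℕ) (j : Fin (m + 1)) (X : HermLattice m) :
    (hermRoots m).refl (some (.inr j)) X = (X.1 + X.2.1 + 2 * X.2.2 j, X.2.1,
      X.2.2 - Pi.single j (X.2.1 + 2 * X.2.2 j)) := by
  rw [RootFamily.refl_apply]
  simp only [hermRoots, hermForm_apply, hermRoot]
  refine Prod.ext ?_ (Prod.ext ?_ ?_) <;> simp [Pi.single_apply]
  · ring
  · ext k
    by_cases hk : k = j
    · subst hk; simp; ring
    · simp [hk]
end

/-! ### The elementary matrices as products of reflections. -/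

noncomputable section

theorem paravec_sub_single (m : ℕ) (b : Fin (m + 1) → ℤ) (j : Fin (m + 1)) (c : ℤ) :
    paravec m (b - Pi.single j c) = paravec m b - c • paraUnit m j := by
  have h : ∀ c : ℤ, paravec m (Pi.single j c) = c • paraUnit m j := by
    intro c
    rw [← paravec_single]
    have := map_zsmul (AddMonoidHom.mk' (paravec m) (paravec_add m)) c (Pi.single j 1)
    simp only [AddMonoidHom.mk'_apply, ← Pi.single_smul, smul_eq_mul, mul_one] at this
    exact this
  have := map_sub (AddMonoidHom.mk' (paravec m) (paravec_add m)) b (Pi.single j c)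
  simp only [AddMonoidHom.mk'_apply, h] at this
  exact this

theorem star_paravec (m : ℕ) (b : Fin (m + 1) → ℤ) :
    star (paravec m b) = -paravec m (b - Pi.single 0 (2 * b 0)) := by
  rw [paravec_sub_single, paravec, star_add, CliffordAlgebra.star_algebraMap,
    CliffordAlgebra.star_ι, paraUnit_zero]
  simp only [map_intCast, zsmul_eq_mul, mul_one]
  push_cast
  noncomm_ring

theorem star_paraUnit_succ (m : ℕ) (k : Fin m) :
    star (paraUnit m k.succ) = -paraUnit m k.succ :=
  star_cliffGen (m + 1) k

theorem cliffGen_mul_ι_add (m : ℕ) (k : Fin m) (b : Fin m → ℤ) :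
    cliffGen (m + 1) k * CliffordAlgebra.ι (cliffForm (m + 1)) (fun l : Fin m => (b l : ℝ)) +
      CliffordAlgebra.ι (cliffForm (m + 1)) (fun l : Fin m => (b l : ℝ)) * cliffGen (m + 1) k =
      -((2 * b k : ℤ) : Cliff (m + 1)) := by
  rw [cliffGen, CliffordAlgebra.ι_mul_ι_add_swap, polar_cliffForm]
  have : (∑ i : Fin (m + 1 - 1), (Pi.single k (1 : ℝ) : Fin (m + 1 - 1) → ℝ) i *
      (fun l : Fin m => (b l : ℝ)) i) = b k := by
    simp [Pi.single_apply]
  have h2 : (-2 * b k : ℝ) = ((-(2 * b k) : ℤ) : ℝ) := by push_cast; ring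
  rw [this, h2, map_intCast, Int.cast_neg]

/-- This polarizes the identity that `x x*` is the squared Euclidean norm on `Vᵐ⁺¹(ℤ)`. -/
theorem paraUnit_mul_star_paravec_add (m : ℕ) (j : Fin (m + 1)) (b : Fin (m + 1) → ℤ) :
    paraUnit m j * star (paravec m b) + paravec m b * star (paraUnit m j) = (2 * b j : ℤ) := by
  refine Fin.cases ?_ (fun k => ?_) j
  · rw [paraUnit_zero, star_paravec, paravec_sub_single]
    simp
  · have := cliffGen_mul_ι_add m k (fun l => b l.succ)
    rw [star_paraUnit_succ, paraUnit_succ, paravec, star_add, CliffordAlgebra.star_algebraMap,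
      CliffordAlgebra.star_ι]
    rw [← neg_eq_iff_eq_neg] at this
    rw [← this, mul_add, add_mul, mul_neg, mul_neg, mul_neg, ← Algebra.commutes]
    abel

theorem paraUnit_mul_star_self (m : ℕ) (j : Fin (m + 1)) :
    paraUnit m j * star (paraUnit m j) = 1 := by
  refine Fin.cases ?_ (fun k => ?_) j
  · simp
  · rw [star_paraUnit_succ, paraUnit_succ, mul_neg, cliffGen_mul_self, neg_neg]

theorem cliffGen_mul_paravec_mul (m : ℕ) (k : Fin m) (b : Fin (m + 1) → ℤ) :
    cliffGen (m + 1) k * paravec m b * cliffGen (m + 1) k =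
      paravec m (b - Pi.single k.succ (2 * b k.succ) - Pi.single 0 (2 * b 0)) := by
  have h1 := cliffGen_mul_ι_add m k (fun l => b l.succ)
  have h2 := cliffGen_mul_self (m + 1) k
  rw [paravec_sub_single, paravec_sub_single, paraUnit_zero, paraUnit_succ, paravec, map_intCast]
  set g := cliffGen (m + 1) k
  set v := CliffordAlgebra.ι (cliffForm (m + 1)) fun l : Fin m => (b l.succ : ℝ)
  calc g * ((b 0 : Cliff (m + 1)) + v) * g
      = g * (b 0 : Cliff (m + 1)) * g + (g * v + v * g) * g - v * (g * g) := by noncomm_ring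
    _ = (b 0 : Cliff (m + 1)) * (g * g) + (g * v + v * g) * g - v * (g * g) := by
      rw [← Int.cast_comm, mul_assoc]
    _ = _ := by
      rw [h1, h2]
      simp only [zsmul_eq_mul, mul_one]
      push_cast
      noncomm_ring

/-- An invertible matrix acts on the hermitian matrices by an automorphism of the lattice. -/
def Acts (m : ℕ) (g : (Matrix (Fin 2) (Fin 2) (Cliff (m + 1)))ˣ)
    (f : HermLattice m ≃ₗ[ℤ] HermLattice m) : Prop :=
  ∀ X, g.val * hermMat m X * star g.val = hermMat m (f X)

theorem Acts.one (m : ℕ) : Acts m 1 1 := fun X => by simp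

theorem Acts.mul {m : ℕ} {g k : (Matrix (Fin 2) (Fin 2) (Cliff (m + 1)))ˣ}
    {f l : HermLattice m ≃ₗ[ℤ] HermLattice m} (h : Acts m g f) (h' : Acts m k l) :
    Acts m (g * k) (f * l) := fun X => by
  rw [LinearEquiv.mul_apply, ← h, ← h', Units.val_mul, star_mul]
  simp only [mul_assoc]

theorem Acts.inv {m : ℕ} {g : (Matrix (Fin 2) (Fin 2) (Cliff (m + 1)))ˣ}
    {f : HermLattice m ≃ₗ[ℤ] HermLattice m} (h : Acts m g f) : Acts m g⁻¹ f⁻¹ := fun X => by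
  have h1 : X = f (f⁻¹ X) := by rw [← LinearEquiv.mul_apply, mul_inv_cancel]; rfl
  have h2 : star g.val * star (g⁻¹).val = 1 := by rw [← star_mul, Units.inv_mul, star_one]
  nth_rewrite 1 [h1]
  rw [← h]
  calc (g⁻¹).val * (g.val * hermMat m (f⁻¹ X) * star g.val) * star (g⁻¹).val
      = ((g⁻¹).val * g.val) * hermMat m (f⁻¹ X) * (star g.val * star (g⁻¹).val) := by
        simp only [mul_assoc]
    _ = _ := by rw [h2, Units.inv_mul, one_mul, mul_one]

/-- The reflection in a simple root. -/
abbrev hermRefl (m : ℕ) (b : Option (Fin (m + 1) ⊕ Fin (m + 1))) :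
    HermLattice m ≃ₗ[ℤ] HermLattice m := (hermRoots m).refl b

theorem hermRefl_mul_self (m : ℕ) (b : Option (Fin (m + 1) ⊕ Fin (m + 1))) :
    hermRefl m b * hermRefl m b = 1 := by
  have := (hermRoots m).isLiftable_refl b b
  rwa [CoxeterMatrix.diagonal, pow_one] at this

/-- `E(0)` is the inversion in the unit sphere followed by the reflection in `x₀ = 0`; the latter
appears because `star` is, up to sign, that reflection on `Vᵐ⁺¹(ℤ)`. -/
theorem acts_elemMat_zero (m : ℕ) :
    Acts m (elemMat 0) (hermRefl m (some (.inl 0)) * hermRefl m none) := fun X => by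
  rw [LinearEquiv.mul_apply, hermRoots_refl_none, hermRoots_refl_inl, hermMat_apply, hermMat_apply,
    ← neg_eq_iff_eq_neg.2 (star_paravec m X.2.2)]
  ext i j
  fin_cases i <;> fin_cases j <;> simp [elemMat, Matrix.mul_apply, Fin.sum_univ_two]

/-- The translation by `-x`, as a matrix. -/
def translMat {R : Type*} [Ring R] (x : R) : (Matrix (Fin 2) (Fin 2) R)ˣ :=
  elemMat x * (elemMat 0)⁻¹

theorem translMat_val {R : Type*} [Ring R] (x : R) : (translMat x).val = !![1, -x; 0, 1] := by
  have : (elemMat (0 : R))⁻¹.val = !![0, -1; 1, 0] := rfl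
  rw [translMat, Units.val_mul, this]
  ext i j
  fin_cases i <;> fin_cases j <;> simp [elemMat, Matrix.mul_apply, Fin.sum_univ_two]

theorem translMat_mul_elemMat_zero {R : Type*} [Ring R] (x : R) :
    translMat x * elemMat 0 = elemMat x := by
  rw [translMat, inv_mul_cancel_right]

/-- A unit translation is the product of the reflections in two parallel walls at distance `1/2`. -/
theorem acts_translMat (m : ℕ) (j : Fin (m + 1)) : Acts m (translMat (paraUnit m j))
    (hermRefl m (some (.inr j)) * hermRefl m (some (.inl j))) := fun X => by
  have e1 := paraUnit_mul_star_paravec_add m j X.2.2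
  have e2 := paraUnit_mul_star_self m j
  have e3 : paravec m (X.2.2 - Pi.single j X.2.1) = paravec m X.2.2 - X.2.1 • paraUnit m j :=
    paravec_sub_single m _ j _
  have e4 : (hermRefl m (some (.inr j)) * hermRefl m (some (.inl j))) X =
      (X.1 + X.2.1 - 2 * X.2.2 j, X.2.1, X.2.2 - Pi.single j X.2.1) := by
    rw [LinearEquiv.mul_apply, hermRoots_refl_inl, hermRoots_refl_inr]
    refine Prod.ext ?_ (Prod.ext rfl ?_)
    · simp; ring
    · ext k
      by_cases hk : k = j
      · subst hk; simp; ring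
      · simp [hk]
  rw [e4, hermMat_apply, hermMat_apply, translMat_val, e3]
  have e5 : (X.1 : Cliff (m + 1)) - paraUnit m j * star (paravec m X.2.2) +
      (paravec m X.2.2 - paraUnit m j * (X.2.1 : Cliff (m + 1))) * -star (paraUnit m j) =
      ((X.1 + X.2.1 - 2 * X.2.2 j : ℤ) : Cliff (m + 1)) := by
    rw [← Int.cast_comm, mul_neg, sub_mul, mul_assoc, e2, Int.cast_sub, ← e1]
    push_cast
    noncomm_ring
  ext i k
  fin_cases i <;> fin_cases k
  · simpa [Matrix.mul_apply, Fin.sum_univ_two, sub_eq_add_neg] using e5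
  · simp [Matrix.mul_apply, Fin.sum_univ_two, sub_eq_add_neg, Int.cast_comm]
  · simp [Matrix.mul_apply, Fin.sum_univ_two, sub_eq_add_neg, Int.cast_comm]
  · simp [Matrix.mul_apply, Fin.sum_univ_two]

theorem acts_elemMat_paraUnit (m : ℕ) (j : Fin (m + 1)) : Acts m (elemMat (paraUnit m j))
    (hermRefl m (some (.inr j)) * hermRefl m (some (.inl j)) *
      (hermRefl m (some (.inl 0)) * hermRefl m none)) := by
  rw [← translMat_mul_elemMat_zero]
  exact (acts_translMat m j).mul (acts_elemMat_zero m)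

/-- The diagonal matrix with entries `-iₖ` and `iₖ`. -/
def diagMat (n : ℕ) (k : Fin (n - 1)) : (Matrix (Fin 2) (Fin 2) (Cliff n))ˣ :=
  elemMat (cliffGen n k) * elemMat (-cliffGen n k) * elemMat (cliffGen n k)

theorem diagMat_val (n : ℕ) (k : Fin (n - 1)) :
    (diagMat n k).val = !![-cliffGen n k, 0; 0, cliffGen n k] := by
  have := cliffGen_mul_self n k
  rw [diagMat, Units.val_mul, Units.val_mul]
  ext i j
  fin_cases i <;> fin_cases j <;> simp [elemMat, Matrix.mul_apply, Fin.sum_univ_two, this]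

theorem diagMat_mul_self (n : ℕ) (k : Fin (n - 1)) : diagMat n k * diagMat n k = -1 := by
  have := cliffGen_mul_self n k
  apply Units.ext
  rw [Units.val_mul, diagMat_val]
  ext i j
  fin_cases i <;> fin_cases j <;> simp [Matrix.mul_apply, Fin.sum_univ_two, this]

/-- A half-turn about the intersection of the orthogonal walls `x₀ = 0` and `xₖ = 0`. -/
theorem acts_diagMat (m : ℕ) (k : Fin m) : Acts m (diagMat (m + 1) k)
    (hermRefl m (some (.inl 0)) * hermRefl m (some (.inl k.succ))) := fun X => by
  have e1 := cliffGen_mul_paravec_mul m k X.2.2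
  have e2 := cliffGen_mul_self (m + 1) k
  have e3 : (hermRefl m (some (.inl 0)) * hermRefl m (some (.inl k.succ))) X = (X.1, X.2.1,
      X.2.2 - Pi.single k.succ (2 * X.2.2 k.succ) - Pi.single 0 (2 * X.2.2 0)) := by
    rw [LinearEquiv.mul_apply, hermRoots_refl_inl, hermRoots_refl_inl]
    simp
  have e4 : ∀ a : ℤ, cliffGen (m + 1) k * (a : Cliff (m + 1)) * cliffGen (m + 1) k = -a := by
    intro a
    rw [← Int.cast_comm, mul_assoc, e2, mul_neg, mul_one]
  rw [e3, hermMat_apply, hermMat_apply, diagMat_val, ← e1]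
  ext i j
  fin_cases i <;> fin_cases j <;>
    simp [Matrix.mul_apply, Fin.sum_univ_two, star_cliffGen, e4, mul_assoc]
end

/-! ### Generators, the kernel of the action, and the invariant Loewner order. -/

noncomputable section

theorem elemMat_add {R : Type*} [Ring R] (x y : R) :
    elemMat (x + y) = elemMat x * (elemMat 0)⁻¹ * elemMat y := by
  rw [← translMat]
  apply Units.ext
  rw [Units.val_mul, translMat, Units.val_mul]
  have : (elemMat (0 : R))⁻¹.val = !![0, -1; 1, 0] := rfl
  rw [this]
  ext i j
  fin_cases i <;> fin_cases j <;> simp [elemMat, Matrix.mul_apply, Fin.sum_univ_two, add_comm]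

theorem elemMat_neg {R : Type*} [Ring R] (x : R) :
    elemMat (-x) = elemMat 0 * (elemMat x)⁻¹ * elemMat 0 := by
  have h := elemMat_add x (-x)
  rw [add_neg_cancel] at h
  calc elemMat (-x)
      = (elemMat x * (elemMat 0)⁻¹)⁻¹ * (elemMat x * (elemMat 0)⁻¹ * elemMat (-x)) := by group
    _ = (elemMat x * (elemMat 0)⁻¹)⁻¹ * elemMat 0 := by rw [← h]
    _ = _ := by group

theorem elemMat_zero_mul_self {R : Type*} [Ring R] : elemMat (0 : R) * elemMat 0 = -1 := by
  ext i j
  fin_cases i <;> fin_cases j <;> simp [elemMat, Matrix.mul_apply, Fin.sum_univ_two]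

/-- The elementary group is generated by the matrices `E(x)`, where `x` is `0` or a unit vector. -/
theorem E2Γ_le_of_elemMat_mem {m : ℕ} {K : Subgroup (Matrix (Fin 2) (Fin 2) (Cliff (m + 1)))ˣ}
    (h0 : elemMat 0 ∈ K) (h1 : ∀ j, elemMat (paraUnit m j) ∈ K) : E2Γ (m + 1) ≤ K := by
  -- By `elemMat_add` and `elemMat_neg` the `x` with `E(x) ∈ K` form an additive group, so it
  -- suffices that it contains a basis of the lattice.
  let A : AddSubgroup (Cliff (m + 1)) :=
    { carrier := {x | elemMat x ∈ K}
      zero_mem' := h0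
      add_mem' := fun {x y} hx hy => by
        change elemMat (x + y) ∈ K
        rw [elemMat_add]
        exact mul_mem (mul_mem hx (inv_mem h0)) hy
      neg_mem' := fun {x} hx => by
        change elemMat (-x) ∈ K
        rw [elemMat_neg]
        exact mul_mem (mul_mem h0 (inv_mem hx)) h0 }
  have hA : cliffVec (m + 1) ≤ AddSubgroup.toIntSubmodule A := by
    refine Submodule.span_le.2 ?_
    rintro _ (rfl | ⟨k, rfl⟩)
    · exact h1 0
    · exact h1 (Fin.succ k)
  refine (Subgroup.closure_le _).2 ?_
  rintro _ ⟨x, hx, rfl⟩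
  exact hA hx

theorem elemMat_zero_mem (n : ℕ) : elemMat 0 ∈ E2Γ n :=
  Subgroup.subset_closure ⟨0, zero_mem _, rfl⟩

theorem paraUnit_mem (m : ℕ) (j : Fin (m + 1)) : paraUnit m j ∈ cliffVec (m + 1) := by
  refine Fin.cases ?_ (fun k => ?_) j
  · exact Submodule.subset_span (Set.mem_insert _ _)
  · exact Submodule.subset_span (Set.mem_insert_of_mem _ ⟨k, rfl⟩)

theorem elemMat_paraUnit_mem (m : ℕ) (j : Fin (m + 1)) : elemMat (paraUnit m j) ∈ E2Γ (m + 1) :=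
  Subgroup.subset_closure ⟨_, paraUnit_mem m j, rfl⟩

/-- The invertible matrices that act on the hermitian matrices by an element of `K`. -/
def actsSubgroup (m : ℕ) (K : Subgroup (HermLattice m ≃ₗ[ℤ] HermLattice m)) :
    Subgroup (Matrix (Fin 2) (Fin 2) (Cliff (m + 1)))ˣ where
  carrier := {g | ∃ f ∈ K, Acts m g f}
  one_mem' := ⟨1, one_mem _, Acts.one m⟩
  mul_mem' := by
    rintro g k ⟨f, hf, hg⟩ ⟨l, hl, hk⟩
    exact ⟨f * l, mul_mem hf hl, hg.mul hk⟩
  inv_mem' := by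
    rintro g ⟨f, hf, hg⟩
    exact ⟨f⁻¹, inv_mem hf, hg.inv⟩

theorem E2Γ_le_actsSubgroup (m : ℕ) : E2Γ (m + 1) ≤
    actsSubgroup m (Subgroup.closure (Set.range (hermRefl m))) := by
  have hr : ∀ b, hermRefl m b ∈ Subgroup.closure (Set.range (hermRefl m)) :=
    fun b => Subgroup.subset_closure ⟨b, rfl⟩
  refine E2Γ_le_of_elemMat_mem ?_ fun j => ?_
  · exact ⟨_, mul_mem (hr _) (hr _), acts_elemMat_zero m⟩
  · exact ⟨_, mul_mem (mul_mem (hr _) (hr _)) (mul_mem (hr _) (hr _)), acts_elemMat_paraUnit m j⟩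

/-- Only `1` and `-1` act trivially on the hermitian matrices. -/
theorem Acts.eq_one_or_eq_neg_one {m : ℕ} {g : (Matrix (Fin 2) (Fin 2) (Cliff (m + 1)))ˣ}
    (hg : g ∈ E2Γ (m + 1)) (h : Acts m g 1) : g = 1 ∨ g = -1 := by
  have hz : paravec m 0 = 0 := (AddMonoidHom.mk' (paravec m) (paravec_add m)).map_zero
  have h1 : g.val * star g.val = 1 := by
    have := h (1, 1, 0)
    have h2 : hermMat m (1, 1, 0) = 1 := by
      rw [hermMat_apply]
      ext i j
      fin_cases i <;> fin_cases j <;> simp [hz]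
    rwa [LinearEquiv.coe_one, id_eq, h2, mul_one] at this
  have h2 : star g.val * g.val = 1 := by
    have h3 : g * star g = 1 := Units.ext h1
    have h4 : star g * g = 1 := by rw [← inv_eq_of_mul_eq_one_right h3, inv_mul_cancel]
    exact congrArg Units.val h4
  have hc : ∀ X, g.val * hermMat m X = hermMat m X * g.val := by
    intro X
    have := h X
    rw [LinearEquiv.coe_one, id_eq] at this
    nth_rewrite 2 [← this]
    rw [mul_assoc _ (star g.val), h2, mul_one]
  refine _root_.eq_one_or_eq_neg_one hg h1 ?_ ?_ fun k => ?_
  · have := hc (1, 0, 0)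
    simpa [hermMat_apply, hz] using this
  · have := hc (0, 0, Pi.single 0 1)
    simpa [hermMat_apply, paravec_single] using this
  · have := hc (0, 0, Pi.single (Fin.succ k) 1)
    rw [hermMat_apply, paravec_single, star_paraUnit_succ, paraUnit_succ] at this
    simpa using this

/-- The positive semidefinite hermitian matrices. -/
def IsPsd {m : ℕ} (X : HermLattice m) : Prop := 0 ≤ X.1 ∧ 0 ≤ X.2.1 ∧ hermForm m X X ≤ 0

theorem hermForm_self (m : ℕ) (X : HermLattice m) :
    hermForm m X X = 2 * (∑ j, X.2.2 j ^ 2 - X.1 * X.2.1) := by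
  rw [hermForm_apply]
  simp only [pow_two]
  ring

theorem IsPsd.eq_zero {m : ℕ} {X : HermLattice m} (h : hermForm m X X ≤ 0) (h' : X.2.1 = 0) :
    X.2.2 = 0 := by
  rw [hermForm_self, h', mul_zero, sub_zero] at h
  have h1 : ∑ j, X.2.2 j ^ 2 = 0 :=
    le_antisymm (by linarith) (Finset.sum_nonneg fun j _ => sq_nonneg _)
  rw [Finset.sum_eq_zero_iff_of_nonneg fun j _ => sq_nonneg _] at h1
  ext j
  exact pow_eq_zero_iff (two_ne_zero) |>.1 (h1 j (Finset.mem_univ j))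

theorem IsPsd.of_form_nonpos {m : ℕ} {X : HermLattice m} (h : hermForm m X X ≤ 0)
    (hd : 0 ≤ X.2.1) (ha : X.2.1 = 0 → 0 ≤ X.1) : IsPsd X := by
  refine ⟨?_, hd, h⟩
  rcases hd.eq_or_lt with h0 | h0
  · exact ha h0.symm
  · rw [hermForm_self] at h
    have h1 : 0 ≤ ∑ j, X.2.2 j ^ 2 := Finset.sum_nonneg fun j _ => sq_nonneg _
    exact nonneg_of_mul_nonneg_left (by linarith : 0 ≤ X.1 * X.2.1) h0

/-- Only the walls `xⱼ = 1/2` need an argument: `X.2.1` is unchanged, and the sign of the other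
diagonal entry follows from the form, or, if `X.2.1 = 0`, from the vanishing of the off-diagonal
entry. -/
theorem IsPsd.refl {m : ℕ} {X : HermLattice m} (h : IsPsd X)
    (b : Option (Fin (m + 1) ⊕ Fin (m + 1))) : IsPsd (hermRefl m b X) := by
  obtain ⟨ha, hd, hf⟩ := h
  have hf' : hermForm m (hermRefl m b X) (hermRefl m b X) ≤ 0 := by
    have := (hermRoots m).form_refl b X X
    exact this.trans_le hf
  rcases b with _ | j | j
  · rw [hermRoots_refl_none] at hf' ⊢
    exact ⟨hd, ha, hf'⟩
  · rw [hermRoots_refl_inl] at hf' ⊢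
    exact ⟨ha, hd, hf'⟩
  · refine .of_form_nonpos hf' ?_ ?_
    · rw [hermRoots_refl_inr]
      exact hd
    · rw [hermRoots_refl_inr]
      intro h0
      have h0' : X.2.1 = 0 := h0
      simpa [h0', congrFun (IsPsd.eq_zero hf h0') j] using ha

theorem IsPsd.of_mem_closure {m : ℕ} {X : HermLattice m} (h : IsPsd X)
    {f : HermLattice m ≃ₗ[ℤ] HermLattice m}
    (hf : f ∈ Subgroup.closure (Set.range (hermRefl m))) : IsPsd (f X) := by
  induction hf using Subgroup.closure_induction'' generalizing X with
  | mem x hx => obtain ⟨b, rfl⟩ := hx; exact h.refl b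
  | inv_mem x hx =>
    obtain ⟨b, rfl⟩ := hx
    rw [inv_eq_of_mul_eq_one_left (hermRefl_mul_self m b)]
    exact h.refl b
  | one => exact h
  | mul x y _ _ hx hy => exact hx (hy h)

theorem IsPsd.add {m : ℕ} {X Y : HermLattice m} (hX : IsPsd X) (hY : IsPsd Y) : IsPsd (X + Y) := by
  obtain ⟨ha, hd, hf⟩ := hX
  obtain ⟨ha', hd', hf'⟩ := hY
  refine ⟨add_nonneg ha ha', add_nonneg hd hd', ?_⟩
  have hcs := Finset.sum_mul_sq_le_sq_mul_sq Finset.univ X.2.2 Y.2.2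
  have hXY : ∑ j, X.2.2 j * Y.2.2 j ≤ |∑ j, X.2.2 j * Y.2.2 j| := le_abs_self _
  rw [hermForm_self] at hf hf'
  -- Cauchy–Schwarz for the off-diagonal entries, combined with the inequality of arithmetic and
  -- geometric means for the diagonal ones. It says that two vectors of the cone have nonpositive
  -- product.
  have h1 : 2 * |∑ j, X.2.2 j * Y.2.2 j| ≤ X.1 * Y.2.1 + X.2.1 * Y.1 := by
    have hp1 := mul_nonneg ha hd'
    have hp2 := mul_nonneg hd ha'
    have h2 : (∑ j, X.2.2 j ^ 2) * ∑ j, Y.2.2 j ^ 2 ≤ (X.1 * X.2.1) * (Y.1 * Y.2.1) :=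
      mul_le_mul (by linarith) (by linarith) (Finset.sum_nonneg fun j _ => sq_nonneg _)
        (mul_nonneg ha hd)
    refine abs_le_of_sq_le_sq' ?_ (by linarith) |>.2
    rw [mul_pow, sq_abs]
    nlinarith [sq_nonneg (X.1 * Y.2.1 - X.2.1 * Y.1)]
  have h3 : hermForm m (X + Y) (X + Y) =
      hermForm m X X + hermForm m Y Y + 2 * hermForm m X Y := by
    rw [map_add, map_add, LinearMap.add_apply, LinearMap.add_apply]
    have := (hermRoots m).symm X Y
    change hermForm m X Y = hermForm m Y X at this
    linarith
  rw [h3, hermForm_self, hermForm_self, hermForm_apply]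
  linarith

/-- The Loewner order on matrices, restricted to integral differences. -/
def hermLT (m : ℕ) (U V : Matrix (Fin 2) (Fin 2) (Cliff (m + 1))) : Prop :=
  ∃ X : HermLattice m, IsPsd X ∧ X ≠ 0 ∧ V = U + hermMat m X

theorem hermLT.trans {m : ℕ} {U V Z : Matrix (Fin 2) (Fin 2) (Cliff (m + 1))}
    (h : hermLT m U V) (h' : hermLT m V Z) : hermLT m U Z := by
  obtain ⟨X, hX, hX0, rfl⟩ := h
  obtain ⟨Y, hY, hY0, rfl⟩ := h'
  refine ⟨X + Y, hX.add hY, ?_, by rw [map_add, add_assoc]⟩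
  intro h0
  have h1 : X.1 + Y.1 = 0 := congrArg Prod.fst h0
  have h2 : X.2.1 + Y.2.1 = 0 := congrArg (fun Z => Z.2.1) h0
  have h3 := hX.1
  have h4 := hX.2.1
  have h5 := hY.1
  have h6 := hY.2.1
  have h7 : X.2.1 = 0 := by linarith
  exact hX0 (Prod.ext (by change X.1 = 0; linarith) (Prod.ext h7 (IsPsd.eq_zero hX.2.2 h7)))

theorem hermLT.irrefl {m : ℕ} (U : Matrix (Fin 2) (Fin 2) (Cliff (m + 1))) : ¬ hermLT m U U := by
  rintro ⟨X, _, hX0, h⟩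
  rw [left_eq_add, ← map_zero (hermMat m)] at h
  exact hX0 (hermMat_injective m h)

theorem hermLT_hermMat_iff {m : ℕ} {X Y : HermLattice m} :
    hermLT m (hermMat m X) (hermMat m Y) ↔ IsPsd (Y - X) ∧ Y ≠ X := by
  constructor
  · rintro ⟨Z, hZ, hZ0, h⟩
    rw [← map_add] at h
    obtain rfl := hermMat_injective m h
    rw [add_sub_cancel_left]
    exact ⟨hZ, by simpa using hZ0⟩
  · rintro ⟨h, hne⟩
    exact ⟨Y - X, h, sub_ne_zero.2 hne, by rw [← map_add, add_sub_cancel]⟩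

/-- The difference `X` is hermitian, so `g` acts on it through a product of simple reflections, each
of which preserves the cone. -/
theorem hermLT.mul_mul_star {m : ℕ} {U V : Matrix (Fin 2) (Fin 2) (Cliff (m + 1))}
    (h : hermLT m U V) {g : (Matrix (Fin 2) (Fin 2) (Cliff (m + 1)))ˣ} (hg : g ∈ E2Γ (m + 1)) :
    hermLT m (g.val * U * star g.val) (g.val * V * star g.val) := by
  obtain ⟨X, hX, hX0, rfl⟩ := h
  obtain ⟨f, hf, hgf⟩ := E2Γ_le_actsSubgroup m hg
  refine ⟨f X, hX.of_mem_closure hf, ?_, ?_⟩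
  · rwa [ne_eq, LinearEquiv.map_eq_zero_iff]
  · rw [← hgf]; noncomm_ring
end

/-! ### The wall `x_last = 0`, its stabilizer, and the half-turns generating the two factors. -/

noncomputable section

/-- The restriction of a root family to a subset of the roots. -/
def RootFamily.restrict {B L : Type*} [AddCommGroup L] (R : RootFamily B L) (S : Set B) :
    RootFamily S L where
  form := R.form
  symm := R.symm
  root b := R.root b
  norm b := R.norm b
  gram a b h := R.gram a b fun h' => h (Subtype.ext h')

theorem RootFamily.restrict_refl {B L : Type*} [AddCommGroup L] (R : RootFamily B L) (S : Set B)
    (b : S) : (R.restrict S).refl b = R.refl b := by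
  ext x
  rw [RootFamily.refl_apply, RootFamily.refl_apply]
  rfl

variable (m : ℕ)

/-- The image of `E₂(Γₘ₊₁(ℤ))` in `E₂(Γₘ₊₂(ℤ))`. -/
def wallGroup : Subgroup (Matrix (Fin 2) (Fin 2) (Cliff (m + 2)))ˣ :=
  (E2Γ (m + 1)).map (matIncl (Nat.le_succ (m + 1)))

theorem cliffIncl_paraUnit (j : Fin (m + 1)) :
    cliffIncl (Nat.le_succ (m + 1)) (paraUnit m j) = paraUnit (m + 1) j.castSucc := by
  refine Fin.cases ?_ (fun k => ?_) j
  · simp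
  · exact cliffIncl_gen (m := m + 1) (n := m + 2) _ k

theorem wallGroup_le : wallGroup m ≤ E2Γ (m + 2) := by
  rintro _ ⟨g, hg, rfl⟩
  exact matIncl_mem (Nat.le_succ (m + 1)) ⟨g, hg⟩

theorem elemMat_zero_mem_wallGroup : elemMat 0 ∈ wallGroup m :=
  ⟨elemMat 0, elemMat_zero_mem _, by rw [matIncl_elemMat, map_zero]⟩

theorem elemMat_mem_wallGroup (j : Fin (m + 1)) :
    elemMat (paraUnit (m + 1) j.castSucc) ∈ wallGroup m :=
  ⟨elemMat (paraUnit m j), elemMat_paraUnit_mem m j, by rw [matIncl_elemMat, cliffIncl_paraUnit]⟩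

theorem elemMat_neg_mem_wallGroup (j : Fin (m + 1)) :
    elemMat (-paraUnit (m + 1) j.castSucc) ∈ wallGroup m := by
  rw [elemMat_neg]
  exact mul_mem (mul_mem (elemMat_zero_mem_wallGroup m) (inv_mem (elemMat_mem_wallGroup m j)))
    (elemMat_zero_mem_wallGroup m)

theorem neg_one_mem_wallGroup : -1 ∈ wallGroup m := by
  rw [← elemMat_zero_mul_self]
  exact mul_mem (elemMat_zero_mem_wallGroup m) (elemMat_zero_mem_wallGroup m)

theorem neg_mem_wallGroup {g : (Matrix (Fin 2) (Fin 2) (Cliff (m + 2)))ˣ} (hg : g ∈ wallGroup m) :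
    -g ∈ wallGroup m := by
  rw [← neg_one_mul]
  exact mul_mem (neg_one_mem_wallGroup m) hg

theorem wallGroup_le_of_elemMat_mem {K : Subgroup (Matrix (Fin 2) (Fin 2) (Cliff (m + 2)))ˣ}
    (h0 : elemMat 0 ∈ K) (h1 : ∀ j : Fin (m + 1), elemMat (paraUnit (m + 1) j.castSucc) ∈ K) :
    wallGroup m ≤ K := by
  refine Subgroup.map_le_iff_le_comap.2 (E2Γ_le_of_elemMat_mem ?_ fun j => ?_)
  · rwa [Subgroup.mem_comap, matIncl_elemMat, map_zero]
  · rw [Subgroup.mem_comap, matIncl_elemMat, cliffIncl_paraUnit]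
    exact h1 j

/-- The vector orthogonal to the wall that is preserved by `wallGroup`. -/
def wallVec : HermLattice (m + 1) := (0, 0, Pi.single (Fin.last (m + 1)) 1)

theorem hermForm_wallVec (X : HermLattice (m + 1)) :
    hermForm (m + 1) (wallVec m) X = 2 * X.2.2 (Fin.last (m + 1)) := by
  simp [hermForm_apply, wallVec, Pi.single_apply]

theorem hermRefl_wallVec (b : Option (Fin (m + 2) ⊕ Fin (m + 2)))
    (hb : b ≠ some (.inl (Fin.last (m + 1)))) (hb' : b ≠ some (.inr (Fin.last (m + 1)))) :
    hermRefl (m + 1) b (wallVec m) = wallVec m := by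
  rcases b with _ | j | j
  · rw [hermRoots_refl_none]; rfl
  · have : j ≠ Fin.last (m + 1) := fun h => hb (by rw [h])
    rw [hermRoots_refl_inl]
    simp [wallVec, this]
  · have : j ≠ Fin.last (m + 1) := fun h => hb' (by rw [h])
    rw [hermRoots_refl_inr]
    simp [wallVec, this]

/-- The automorphisms of the lattice that fix `wallVec`. -/
def wallStab : Subgroup (HermLattice (m + 1) ≃ₗ[ℤ] HermLattice (m + 1)) where
  carrier := {f | f (wallVec m) = wallVec m}
  one_mem' := rfl
  mul_mem' := fun {f g} (hf : f _ = _) (hg : g _ = _) => (congrArg f hg).trans hf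
  inv_mem' := fun {f} (hf : f _ = _) => by
    change f⁻¹ (wallVec m) = wallVec m
    nth_rewrite 1 [← hf]
    rw [← LinearEquiv.mul_apply, inv_mul_cancel]
    rfl

theorem last_ne_zero : (0 : Fin (m + 2)) ≠ Fin.last (m + 1) :=
  (Fin.last_pos).ne

theorem wallGroup_le_actsSubgroup : wallGroup m ≤ actsSubgroup (m + 1) (wallStab m) := by
  have h0 : hermRefl (m + 1) (some (.inl 0)) * hermRefl (m + 1) none ∈ wallStab m :=
    mul_mem (hermRefl_wallVec m _ (by simp) (by simp))
      (hermRefl_wallVec m _ (by simp) (by simp))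
  refine wallGroup_le_of_elemMat_mem m ⟨_, h0, acts_elemMat_zero _⟩ fun j =>
    ⟨_, mul_mem (mul_mem ?_ ?_) h0, acts_elemMat_paraUnit _ _⟩
  · exact hermRefl_wallVec m _ (by simp) (by simp [j.castSucc_lt_last.ne])
  · exact hermRefl_wallVec m _ (by simp [j.castSucc_lt_last.ne]) (by simp)

/-- The rotation that exchanges the two sides of the wall. -/
abbrev wallFlip : (Matrix (Fin 2) (Fin 2) (Cliff (m + 2)))ˣ := diagMat (m + 2) (Fin.last m)

theorem acts_wallFlip : Acts (m + 1) (wallFlip m) (hermRefl (m + 1) (some (.inl 0)) *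
    hermRefl (m + 1) (some (.inl (Fin.last (m + 1))))) :=
  acts_diagMat (m + 1) (Fin.last m)

/-- The rotation that exchanges the wall with its nearest translate. -/
def wallShift : (Matrix (Fin 2) (Fin 2) (Cliff (m + 2)))ˣ :=
  wallFlip m * (translMat (paraUnit (m + 1) (Fin.last (m + 1))))⁻¹

/-- The reflections in `x_last = 0` coming from the half-turn and from the translation cancel. What
remains avoids that wall, as needed for an element preserving the slab. -/
theorem acts_wallShift : Acts (m + 1) (wallShift m) (hermRefl (m + 1) (some (.inl 0)) *
    hermRefl (m + 1) (some (.inr (Fin.last (m + 1))))) := by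
  have := (acts_wallFlip m).mul (acts_translMat (m + 1) (Fin.last (m + 1))).inv
  rwa [mul_inv_rev, inv_eq_of_mul_eq_one_left (hermRefl_mul_self (m + 1) _),
    inv_eq_of_mul_eq_one_left (hermRefl_mul_self (m + 1) _), mul_assoc,
    ← mul_assoc (hermRefl (m + 1) (some (.inl (Fin.last (m + 1))))), hermRefl_mul_self,
    one_mul] at this

theorem diagMat_mem (n : ℕ) (k : Fin n) : diagMat (n + 1) k ∈ E2Γ (n + 1) := by
  have h1 := elemMat_paraUnit_mem n k.succ
  have h2 : elemMat (-cliffGen (n + 1) k) ∈ E2Γ (n + 1) := by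
    rw [elemMat_neg]
    exact mul_mem (mul_mem (elemMat_zero_mem _) (inv_mem h1)) (elemMat_zero_mem _)
  exact mul_mem (mul_mem h1 h2) h1

theorem wallShift_mem : wallShift m ∈ E2Γ (m + 2) :=
  mul_mem (diagMat_mem (m + 1) _) (inv_mem (mul_mem (elemMat_paraUnit_mem _ _)
    (inv_mem (elemMat_zero_mem _))))

/-- The rotation `wallFlip` normalizes the image of the smaller elementary group. -/
theorem wallFlip_conj_mem {g : (Matrix (Fin 2) (Fin 2) (Cliff (m + 2)))ˣ} (hg : g ∈ wallGroup m) :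
    wallFlip m * g * (wallFlip m)⁻¹ ∈ wallGroup m := by
  -- Conjugating `E(u)` by the half-turn gives `-E(v)`, where `v = -1` for `u = 1` and `v = u` for
  -- `u = 0` or another generator, which anticommutes with the last one.
  have key : ∀ u v : Cliff (m + 2), -(cliffGen (m + 2) (Fin.last m) * u) =
      v * cliffGen (m + 2) (Fin.last m) → elemMat v ∈ wallGroup m →
      wallFlip m * elemMat u * (wallFlip m)⁻¹ ∈ wallGroup m := by
    intro u v huv hv
    have : wallFlip m * elemMat u * (wallFlip m)⁻¹ = -elemMat v := by
      rw [mul_inv_eq_iff_eq_mul]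
      apply Units.ext
      rw [Units.val_mul, Units.val_mul, diagMat_val]
      ext i j
      fin_cases i <;> fin_cases j <;>
        simp [elemMat, Matrix.mul_apply, Fin.sum_univ_two, huv]
    rw [this]
    exact neg_mem_wallGroup m hv
  have h : wallGroup m ≤ (wallGroup m).comap (MulAut.conj (wallFlip m)).toMonoidHom := by
    refine wallGroup_le_of_elemMat_mem m ?_ fun j => ?_
    · exact key 0 0 (by simp) (elemMat_zero_mem_wallGroup m)
    · refine Fin.cases ?_ (fun k => ?_) j
      · exact key 1 (-1) (by simp) (elemMat_neg_mem_wallGroup m 0)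
      · have hk : k.castSucc ≠ Fin.last m := k.castSucc_lt_last.ne
        refine key _ _ ?_ (elemMat_mem_wallGroup m k.succ)
        exact (cliffGen_anticomm (m + 2) hk).symm
  exact h hg

theorem wallFlip_inv : (wallFlip m)⁻¹ = -wallFlip m := by
  rw [inv_eq_iff_mul_eq_one, mul_neg, diagMat_mul_self, neg_neg]

/-- The stabilizer of the wall. -/
def flipGroup : Subgroup (Matrix (Fin 2) (Fin 2) (Cliff (m + 2)))ˣ :=
  wallGroup m ⊔ Subgroup.zpowers (wallFlip m)

/-- `wallFlip` normalizes `wallGroup` and its square `-1` lies there, so the index is at most two.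
-/
theorem mem_wallGroup_or_of_mem_flipGroup {g : (Matrix (Fin 2) (Fin 2) (Cliff (m + 2)))ˣ}
    (hg : g ∈ flipGroup m) : g ∈ wallGroup m ∨ wallFlip m * g ∈ wallGroup m := by
  have hq : wallFlip m * wallFlip m ∈ wallGroup m := by
    rw [diagMat_mul_self]; exact neg_one_mem_wallGroup m
  have hconj : ∀ g ∈ wallGroup m, wallFlip m * g * wallFlip m ∈ wallGroup m := by
    intro g hg
    have := neg_mem_wallGroup m (wallFlip_conj_mem m hg)
    rwa [wallFlip_inv, mul_neg, neg_neg] at this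
  let K : Subgroup (Matrix (Fin 2) (Fin 2) (Cliff (m + 2)))ˣ :=
    { carrier := {g | g ∈ wallGroup m ∨ wallFlip m * g ∈ wallGroup m}
      one_mem' := .inl (one_mem _)
      mul_mem' := by
        rintro g k (hg | hg) (hk | hk)
        · exact .inl (mul_mem hg hk)
        · right
          have := mul_mem (wallFlip_conj_mem m hg) hk
          convert this using 1
          group
        · right
          rw [← mul_assoc]
          exact mul_mem hg hk
        · left
          have := neg_mem_wallGroup m (mul_mem (neg_mem_wallGroup m (hconj _ hg)) hk)
          have h2 : wallFlip m * (wallFlip m * g) * wallFlip m * (wallFlip m * k) = g * k := by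
            calc wallFlip m * (wallFlip m * g) * wallFlip m * (wallFlip m * k)
                = (wallFlip m * wallFlip m) * g * (wallFlip m * wallFlip m) * k := by group
              _ = g * k := by rw [diagMat_mul_self]; simp
          rwa [neg_mul, neg_neg, h2] at this
      inv_mem' := by
        rintro g (hg | hg)
        · exact .inl (inv_mem hg)
        · right
          have := hconj _ (inv_mem hg)
          convert this using 1
          group }
  have : flipGroup m ≤ K := by
    refine sup_le (fun g hg => .inl hg) ?_
    rw [Subgroup.zpowers_le]
    exact .inr hq
  exact this hg

/-- The action of the elementary group on matrices. -/
def matAct (g : E2Γ (m + 2)) (X : Matrix (Fin 2) (Fin 2) (Cliff (m + 2))) :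
    Matrix (Fin 2) (Fin 2) (Cliff (m + 2)) := g.1.val * X * star g.1.val

theorem wallFlip_wallVec : (hermRefl (m + 1) (some (.inl 0)) *
    hermRefl (m + 1) (some (.inl (Fin.last (m + 1))))) (wallVec m) = -wallVec m := by
  have h0 := last_ne_zero m
  rw [LinearEquiv.mul_apply, hermRoots_refl_inl, hermRoots_refl_inl]
  refine Prod.ext (by simp [wallVec]) (Prod.ext (by simp [wallVec]) ?_)
  ext k
  by_cases hk : k = Fin.last (m + 1)
  · subst hk; simp [wallVec]
  · by_cases hk0 : k = 0
    · subst hk0; simp [wallVec, h0]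
    · simp [wallVec, hk]

theorem wallShift_wallVec : (hermRefl (m + 1) (some (.inl 0)) *
    hermRefl (m + 1) (some (.inr (Fin.last (m + 1))))) (wallVec m) ≠ wallVec m := by
  intro h
  have := congrArg Prod.fst h
  rw [LinearEquiv.mul_apply, hermRoots_refl_inr, hermRoots_refl_inl] at this
  simp [wallVec] at this

/-- Used to show that neither `wallFlip` nor `wallShift` lies in `wallGroup`, that is, that the
amalgam is non-trivial. -/
theorem not_mem_wallGroup_of_acts {g : (Matrix (Fin 2) (Fin 2) (Cliff (m + 2)))ˣ}
    {f : HermLattice (m + 1) ≃ₗ[ℤ] HermLattice (m + 1)} (h : Acts (m + 1) g f)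
    (hf : f (wallVec m) ≠ wallVec m) : g ∉ wallGroup m := by
  intro hg
  obtain ⟨f', hf', hg'⟩ := wallGroup_le_actsSubgroup m hg
  apply hf
  rw [← hermMat_injective (m + 1) ((hg' (wallVec m)).symm.trans (h (wallVec m)))]
  exact hf'

end

/-! ### The slab: its Coxeter group and the ping-pong estimate. -/

noncomputable section
variable (m : ℕ)

/-- The simple roots other than `wallVec`. -/
def slabRoots : RootFamily {b : Option (Fin (m + 2) ⊕ Fin (m + 2)) |
    b ≠ some (.inl (Fin.last (m + 1)))} (HermLattice (m + 1)) :=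
  (hermRoots (m + 1)).restrict _

theorem slabRoots_refl (b : {b : Option (Fin (m + 2) ⊕ Fin (m + 2)) |
    b ≠ some (.inl (Fin.last (m + 1)))}) : (slabRoots m).refl b = hermRefl (m + 1) b :=
  RootFamily.restrict_refl _ _ b

/-- The rotations in the Coxeter group of a root family. -/
def RootFamily.rotations {B L : Type*} [AddCommGroup L] (R : RootFamily B L) :
    Subgroup (L ≃ₗ[ℤ] L) :=
  R.cox.lengthParity.ker.map R.rep

theorem RootFamily.refl_mul_refl_mem_rotations {B L : Type*} [AddCommGroup L]
    (R : RootFamily B L) (a b : B) : R.refl a * R.refl b ∈ R.rotations := by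
  refine ⟨R.cox.simple a * R.cox.simple b, ?_, by rw [map_mul, R.rep_simple, R.rep_simple]⟩
  change R.cox.lengthParity _ = 1
  rw [map_mul, R.cox.lengthParity_simple, R.cox.lengthParity_simple]
  rfl

theorem hermRefl_mul_hermRefl_mem_rotations (a b : Option (Fin (m + 2) ⊕ Fin (m + 2)))
    (ha : a ≠ some (.inl (Fin.last (m + 1)))) (hb : b ≠ some (.inl (Fin.last (m + 1)))) :
    hermRefl (m + 1) a * hermRefl (m + 1) b ∈ (slabRoots m).rotations := by
  have := (slabRoots m).refl_mul_refl_mem_rotations ⟨a, ha⟩ ⟨b, hb⟩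
  rwa [slabRoots_refl, slabRoots_refl] at this

/-- The stabilizer of the slab between the wall and its nearest translate. -/
def shiftGroup : Subgroup (Matrix (Fin 2) (Fin 2) (Cliff (m + 2)))ˣ :=
  wallGroup m ⊔ Subgroup.zpowers (wallShift m)

theorem wallGroup_le_rotations :
    wallGroup m ≤ actsSubgroup (m + 1) (slabRoots m).rotations := by
  have h0 : hermRefl (m + 1) (some (.inl 0)) * hermRefl (m + 1) none ∈ (slabRoots m).rotations :=
    hermRefl_mul_hermRefl_mem_rotations m _ _ (by simp) (by simp)
  refine wallGroup_le_of_elemMat_mem m ⟨_, h0, acts_elemMat_zero _⟩ fun j =>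
    ⟨_, mul_mem ?_ h0, acts_elemMat_paraUnit _ _⟩
  exact hermRefl_mul_hermRefl_mem_rotations m _ _ (by simp) (by simp [j.castSucc_lt_last.ne])

theorem shiftGroup_le_rotations :
    shiftGroup m ≤ actsSubgroup (m + 1) (slabRoots m).rotations := by
  refine sup_le (wallGroup_le_rotations m) ?_
  rw [Subgroup.zpowers_le]
  exact ⟨_, hermRefl_mul_hermRefl_mem_rotations m _ _ (by simp) (by simp), acts_wallShift m⟩

/-- The root of the translate of the wall, as a simple root of the slab. -/
def slabTop : {b : Option (Fin (m + 2) ⊕ Fin (m + 2)) | b ≠ some (.inl (Fin.last (m + 1)))} :=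
  ⟨some (.inr (Fin.last (m + 1))), by simp⟩

/-- Matrices realize only rotations, so a single reflection is paired with the fixed reflection in
`x₀ = 0`. For `xⱼ = 1/2` the half-turn for `xⱼ = 0` is composed with an inverse translation. -/
theorem exists_wallGroup_acts (b : Option (Fin (m + 2) ⊕ Fin (m + 2)))
    (hb : b ≠ some (.inl (Fin.last (m + 1)))) (hb' : b ≠ some (.inr (Fin.last (m + 1)))) :
    ∃ g ∈ wallGroup m, Acts (m + 1) g (hermRefl (m + 1) (some (.inl 0)) * hermRefl (m + 1) b) := by
  have hinl : ∀ j : Fin (m + 1), ∃ g ∈ wallGroup m, Acts (m + 1) g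
      (hermRefl (m + 1) (some (.inl 0)) * hermRefl (m + 1) (some (.inl j.castSucc))) := by
    intro j
    refine Fin.cases ?_ (fun k => ?_) j
    · refine ⟨1, one_mem _, ?_⟩
      have := hermRefl_mul_self (m + 1) (some (.inl 0))
      rw [Fin.castSucc_zero, this]
      exact Acts.one _
    · refine ⟨_, ?_, acts_diagMat (m + 1) k.castSucc⟩
      have h1 := elemMat_mem_wallGroup m k.succ
      have h2 := elemMat_neg_mem_wallGroup m k.succ
      exact mul_mem (mul_mem h1 h2) h1
  rcases b with _ | j | j
  · exact ⟨_, elemMat_zero_mem_wallGroup m, acts_elemMat_zero _⟩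
  · induction j using Fin.lastCases with
    | last => exact absurd rfl hb
    | cast j => exact hinl j
  · induction j using Fin.lastCases with
    | last => exact absurd rfl hb'
    | cast j =>
      obtain ⟨g, hg, hga⟩ := hinl j
      refine ⟨g * (translMat (paraUnit (m + 1) j.castSucc))⁻¹, mul_mem hg (inv_mem
        (mul_mem (elemMat_mem_wallGroup m j) (inv_mem (elemMat_zero_mem_wallGroup m)))), ?_⟩
      have := hga.mul (acts_translMat (m + 1) j.castSucc).inv
      rwa [mul_inv_rev, inv_eq_of_mul_eq_one_left (hermRefl_mul_self (m + 1) _),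
        inv_eq_of_mul_eq_one_left (hermRefl_mul_self (m + 1) _), mul_assoc,
        ← mul_assoc (hermRefl (m + 1) (some (.inl j.castSucc))), hermRefl_mul_self,
        one_mul] at this

/-- The rotations of the parabolic subgroup fixing `wallVec` come from `wallGroup`. -/
theorem exists_wallGroup_acts_of_mem_parabolic {w : (slabRoots m).Weyl}
    (hw : w ∈ Subgroup.closure ((slabRoots m).cox.simple '' {b | b ≠ slabTop m})) :
    ((slabRoots m).cox.lengthParity w = 1 →
      ∃ g ∈ wallGroup m, Acts (m + 1) g ((slabRoots m).rep w)) ∧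
    ((slabRoots m).cox.lengthParity w = Multiplicative.ofAdd 1 →
      ∃ g ∈ wallGroup m, Acts (m + 1) g
        (hermRefl (m + 1) (some (.inl 0)) * (slabRoots m).rep w)) := by
  -- A simple reflection changes the parity, so the even and the odd statement have to be carried
  -- through the induction together.
  have step : ∀ b, b ≠ slabTop m → ∀ y : (slabRoots m).Weyl,
      (((slabRoots m).cox.lengthParity y = 1 →
        ∃ g ∈ wallGroup m, Acts (m + 1) g ((slabRoots m).rep y)) ∧
      ((slabRoots m).cox.lengthParity y = Multiplicative.ofAdd 1 →
        ∃ g ∈ wallGroup m, Acts (m + 1) g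
          (hermRefl (m + 1) (some (.inl 0)) * (slabRoots m).rep y))) →
      (((slabRoots m).cox.lengthParity ((slabRoots m).cox.simple b * y) = 1 →
        ∃ g ∈ wallGroup m, Acts (m + 1) g ((slabRoots m).rep ((slabRoots m).cox.simple b * y))) ∧
      ((slabRoots m).cox.lengthParity ((slabRoots m).cox.simple b * y) = Multiplicative.ofAdd 1 →
        ∃ g ∈ wallGroup m, Acts (m + 1) g
          (hermRefl (m + 1) (some (.inl 0)) *
            (slabRoots m).rep ((slabRoots m).cox.simple b * y)))) := by
    intro b hb y hy
    obtain ⟨g, hg, hga⟩ := exists_wallGroup_acts m b b.2 fun h => hb (Subtype.ext h)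
    rw [map_mul, map_mul, CoxeterSystem.lengthParity_simple, RootFamily.rep_simple, slabRoots_refl]
    constructor
    · intro h
      obtain ⟨k, hk, hka⟩ := hy.2 (by
        rw [mul_eq_one_iff_inv_eq] at h; rw [← h]; rfl)
      refine ⟨g⁻¹ * k, mul_mem (inv_mem hg) hk, ?_⟩
      have := hga.inv.mul hka
      rwa [mul_inv_rev, inv_eq_of_mul_eq_one_left (hermRefl_mul_self (m + 1) _),
        inv_eq_of_mul_eq_one_left (hermRefl_mul_self (m + 1) _), mul_assoc,
        ← mul_assoc (hermRefl (m + 1) (some (.inl 0))), hermRefl_mul_self, one_mul] at this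
    · intro h
      obtain ⟨k, hk, hka⟩ := hy.1 (by rwa [mul_eq_left] at h)
      refine ⟨g * k, mul_mem hg hk, ?_⟩
      rw [← mul_assoc]
      exact hga.mul hka
  induction hw using Subgroup.closure_induction_left with
  | one =>
    refine ⟨fun _ => ⟨1, one_mem _, by rw [map_one]; exact Acts.one _⟩, fun h => ?_⟩
    rw [map_one] at h
    exact absurd h (by decide)
  | mul_left x hx y _ hy =>
    obtain ⟨b, hb, rfl⟩ := hx
    exact step b hb y hy
  | inv_mul_cancel x hx y _ hy =>
    obtain ⟨b, hb, rfl⟩ := hx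
    rw [CoxeterSystem.inv_simple]
    exact step b hb y hy

theorem slabRoots_form_root (b : {b : Option (Fin (m + 2) ⊕ Fin (m + 2)) |
    b ≠ some (.inl (Fin.last (m + 1)))}) (hb : b ≠ slabTop m) :
    (slabRoots m).form (-wallVec m) ((slabRoots m).root b) = 0 := by
  change hermForm (m + 1) (-wallVec m) (hermRoot (m + 1) b) = 0
  rw [map_neg, LinearMap.neg_apply, hermForm_wallVec]
  obtain ⟨_ | j | j, hb1⟩ := b
  · simp [hermRoot]
  · have : Fin.last (m + 1) ≠ j := by rintro rfl; exact hb1 rfl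
    simp [hermRoot, this]
  · have : Fin.last (m + 1) ≠ j := by rintro rfl; exact hb rfl
    simp [hermRoot, this]

theorem slabRoots_form_slabTop :
    (slabRoots m).form (-wallVec m) ((slabRoots m).root (slabTop m)) = 2 := by
  change hermForm (m + 1) (-wallVec m) (hermRoot (m + 1) _) = 2
  rw [map_neg, LinearMap.neg_apply, hermForm_wallVec]
  simp [hermRoot, slabTop]

/-- Linear functionals that are nonnegative on the roots of the slab. The first two control the
diagonal entries in `mem_wallGroup_or_hermLT`; the third excludes equality there. -/
theorem slabRoots_positive {X : HermLattice (m + 1)} (hX : X ∈ (slabRoots m).positive) :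
    0 ≤ X.2.1 ∧ 0 ≤ X.1 + X.2.1 ∧ 0 ≤ X.1 + X.2.1 + X.2.2 (Fin.last (m + 1)) := by
  induction hX using AddSubmonoid.closure_induction with
  | mem X hX =>
    obtain ⟨b, rfl⟩ := hX
    change 0 ≤ (hermRoot (m + 1) b).2.1 ∧ _ ≤ (hermRoot (m + 1) b).1 + (hermRoot (m + 1) b).2.1 ∧
      _ ≤ (hermRoot (m + 1) b).1 + (hermRoot (m + 1) b).2.1 +
        (hermRoot (m + 1) b).2.2 (Fin.last (m + 1))
    rcases b.1 with _ | j | j <;> simp only [hermRoot, Pi.single_apply, Pi.zero_apply, Pi.neg_apply]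
    · simp
    all_goals split_ifs <;> simp
  | zero => simp
  | add X Y _ _ hX hY =>
    simp only [Prod.fst_add, Prod.snd_add, Pi.add_apply]
    lia

/-- An element that preserves the slab stabilizes the wall or maps its outer side into the inner
side. -/
theorem mem_wallGroup_or_hermLT {g : (Matrix (Fin 2) (Fin 2) (Cliff (m + 2)))ˣ}
    (hg : g ∈ shiftGroup m) (hgE : g ∈ E2Γ (m + 2)) : g ∈ wallGroup m ∨
      hermLT (m + 1) (g.val * hermMat (m + 1) (-wallVec m) * star g.val)
        (hermMat (m + 1) (wallVec m)) := by
  obtain ⟨_, ⟨w, hw, rfl⟩, hga⟩ := shiftGroup_le_rotations m hg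
  rcases (slabRoots m).mem_parabolic_or (-wallVec m) (slabTop m) (slabRoots_form_slabTop m)
    (slabRoots_form_root m) w with hp | ⟨x, hx, hwx, hx4⟩
  · left
    obtain ⟨k, hk, hka⟩ := (exists_wallGroup_acts_of_mem_parabolic m hp).1 hw
    -- A rotation in the parabolic subgroup is realized by some `k` in `wallGroup`. Then `k⁻¹ g`
    -- acts trivially, hence is `1` or `-1`, and both lie in `wallGroup`.
    have h1 := hka.inv.mul hga
    rw [inv_mul_cancel] at h1
    rcases h1.eq_one_or_eq_neg_one (mul_mem (inv_mem (wallGroup_le m hk)) hgE) with h2 | h2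
    · rw [inv_mul_eq_one] at h2
      rwa [← h2]
    · rw [inv_mul_eq_iff_eq_mul, mul_neg, mul_one] at h2
      rw [h2]
      exact neg_mem_wallGroup m hk
  · right
    rw [hga, hwx, hermLT_hermMat_iff]
    obtain ⟨h1, h2, h3⟩ := slabRoots_positive m hx
    constructor
    · refine .of_form_nonpos ?_ ?_ ?_
      -- Both `wallVec` and the image of `-wallVec` have norm `2`. The bound `4` makes their product
      -- at least `2`, so their difference has norm at most `2 + 2 - 4 = 0`.
      · have e1 : hermForm (m + 1) (-wallVec m - x) (-wallVec m - x) = 2 := by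
          rw [← hwx]
          refine ((slabRoots m).form_rep w _ _).trans ?_
          change hermForm (m + 1) (-wallVec m) (-wallVec m) = 2
          rw [map_neg, map_neg, LinearMap.neg_apply, hermForm_wallVec]
          simp [wallVec]
        have e2 : hermForm (m + 1) (wallVec m) (wallVec m) = 2 := by
          rw [hermForm_wallVec]; simp [wallVec]
        have e3 : 4 ≤ -hermForm (m + 1) (wallVec m) x := by
          have : hermForm (m + 1) (-wallVec m) x = -hermForm (m + 1) (wallVec m) x := by
            rw [map_neg, LinearMap.neg_apply]
          rw [← this]
          exact hx4
        have e4 : hermForm (m + 1) x (wallVec m) = hermForm (m + 1) (wallVec m) x :=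
          (slabRoots m).symm _ _
        simp only [map_sub, map_neg, LinearMap.sub_apply, LinearMap.neg_apply] at e1 ⊢
        linarith
      · simpa [wallVec] using h1
      · simp only [wallVec, Prod.snd_sub, Prod.fst_sub, Prod.snd_neg, Prod.fst_neg]
        lia
    · intro h
      have hx' : x = -wallVec m - wallVec m := by
        nth_rewrite 2 [h]
        abel
      rw [hx'] at h3
      simp [wallVec] at h3
end

/-! ### Injectivity of the inclusion, generation by the two factors, and the splitting for `n ≥ 2`.
-/

noncomputable section
variable (m : ℕ)

theorem cliffIncl_star {k n : ℕ} (h : k ≤ n) (x : Cliff k) :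
    cliffIncl h (star x) = star (cliffIncl h x) := by
  induction x using CliffordAlgebra.induction with
  | algebraMap r =>
    rw [CliffordAlgebra.star_algebraMap, AlgHom.commutes, CliffordAlgebra.star_algebraMap]
  | ι v =>
    rw [CliffordAlgebra.star_ι, map_neg, cliffIncl, CliffordAlgebra.map_apply_ι,
      CliffordAlgebra.star_ι]
  | mul x y hx hy => rw [star_mul, map_mul, hx, hy, map_mul, star_mul]
  | add x y hx hy => rw [star_add, map_add, hx, hy, map_add, star_add]

theorem cliffIncl_paravec_injective {k n : ℕ} (h : k + 1 ≤ n) :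
    Function.Injective fun b => cliffIncl h (paravec k b) := by
  intro b c hbc
  have h1 : cliffIncl h (paravec k (b - c)) = 0 := by
    have : paravec k (b - c) = paravec k b - paravec k c :=
      map_sub (AddMonoidHom.mk' (paravec k) (paravec_add k)) b c
    rw [this, map_sub]
    exact sub_eq_zero.2 hbc
  rw [paravec, map_add, AlgHom.commutes, cliffIncl, CliffordAlgebra.map_apply_ι] at h1
  obtain ⟨h2, h3⟩ := algebraMap_add_ι_eq_zero h1
  have hinj := Fin.castLE_injective (Nat.sub_le_sub_right h 1)
  rw [← sub_eq_zero]
  ext i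
  refine Fin.cases ?_ (fun l => ?_) i
  · exact_mod_cast h2
  · have h4 : Function.extend (Fin.castLE (Nat.sub_le_sub_right h 1))
        (fun l : Fin k => (((b - c) l.succ : ℤ) : ℝ)) 0 = 0 := h3
    have h5 := congrFun h4 (Fin.castLE (Nat.sub_le_sub_right h 1) l)
    rw [hinj.extend_apply] at h5
    exact Int.cast_eq_zero.1 h5

/-- An element of the kernel acts trivially on the hermitian matrices, because the inclusion is
injective on their entries. So it is `1` or `-1`, and `-1` does not map to `1`. -/
theorem E2ΓIncl_injective {k n : ℕ} (h : k + 1 ≤ n) : Function.Injective (E2ΓIncl h) := by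
  rw [injective_iff_map_eq_one]
  intro g hg
  have hg1 : matIncl h g.1 = 1 := congrArg Subtype.val hg
  obtain ⟨f, -, hf⟩ := E2Γ_le_actsSubgroup k g.2
  let ψ : Matrix (Fin 2) (Fin 2) (Cliff (k + 1)) →+* Matrix (Fin 2) (Fin 2) (Cliff n) :=
    (cliffIncl h).toRingHom.mapMatrix
  have hψ : ∀ M, ψ (star M) = star (ψ M) := by
    intro M
    ext i j
    exact cliffIncl_star h _
  have hψg : ψ g.1.val = 1 := congrArg Units.val hg1
  have hf1 : f = 1 := by
    ext1 X
    have h1 := congrArg ψ (hf X)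
    rw [map_mul, map_mul, hψ, hψg, star_one, one_mul, mul_one] at h1
    have hc : ∀ a b : ℤ, cliffIncl h (a : Cliff (k + 1)) = cliffIncl h b → a = b := by
      intro a b hab
      rw [map_intCast, map_intCast] at hab
      have : algebraMap ℝ (Cliff n) a = algebraMap ℝ (Cliff n) b := by simpa using hab
      exact_mod_cast (algebraMap ℝ (Cliff n)).injective this
    refine Prod.ext ?_ (Prod.ext ?_ ?_)
    · exact hc _ _ (congrFun (congrFun h1.symm 0) 0)
    · exact hc _ _ (congrFun (congrFun h1.symm 1) 1)
    · exact cliffIncl_paravec_injective h (congrFun (congrFun h1.symm 0) 1)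
  rw [hf1] at hf
  rcases hf.eq_one_or_eq_neg_one g.2 with h1 | h1
  · exact Subtype.ext h1
  · exfalso
    have h2 : ψ g.1.val = -1 := by rw [h1, Units.val_neg, Units.val_one, map_neg, map_one]
    rw [hψg] at h2
    have h3 := congrFun (congrFun h2 0) 0
    rw [Matrix.neg_apply, Matrix.one_apply_eq] at h3
    have h4 : algebraMap ℝ (Cliff n) 1 = algebraMap ℝ (Cliff n) (-1) := by
      rw [map_neg, map_one]; exact h3
    have := (algebraMap ℝ (Cliff n)).injective h4
    norm_num at this

theorem E2ΓIncl_mem_wallGroup (g : E2Γ (m + 1)) :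
    (E2ΓIncl (Nat.le_succ (m + 1)) g).1 ∈ wallGroup m := ⟨g, g.2, rfl⟩

theorem flipGroup_le : flipGroup m ≤ E2Γ (m + 2) := by
  refine sup_le (wallGroup_le m) ?_
  rw [Subgroup.zpowers_le]
  exact diagMat_mem (m + 1) _

theorem shiftGroup_le : shiftGroup m ≤ E2Γ (m + 2) := by
  refine sup_le (wallGroup_le m) ?_
  rw [Subgroup.zpowers_le]
  exact wallShift_mem m

/-- The only generator not already in `wallGroup` is `E` of the last unit vector; its translation is
the product of the two half-turns `(wallShift)⁻¹` and `wallFlip`. -/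
theorem E2Γ_le_sup : E2Γ (m + 2) ≤ flipGroup m ⊔ shiftGroup m := by
  have hw : wallGroup m ≤ flipGroup m ⊔ shiftGroup m := le_sup_left.trans le_sup_left
  have hf : wallFlip m ∈ flipGroup m ⊔ shiftGroup m :=
    (le_sup_left : flipGroup m ≤ _) ((le_sup_right : _ ≤ flipGroup m) (Subgroup.mem_zpowers _))
  have hs : wallShift m ∈ flipGroup m ⊔ shiftGroup m :=
    (le_sup_right : shiftGroup m ≤ _) ((le_sup_right : _ ≤ shiftGroup m) (Subgroup.mem_zpowers _))
  refine E2Γ_le_of_elemMat_mem (hw (elemMat_zero_mem_wallGroup m)) fun j => ?_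
  induction j using Fin.lastCases with
  | cast j => exact hw (elemMat_mem_wallGroup m j)
  | last =>
    have : elemMat (paraUnit (m + 1) (Fin.last (m + 1))) =
        (wallShift m)⁻¹ * wallFlip m * elemMat 0 := by
      rw [← translMat_mul_elemMat_zero (paraUnit (m + 1) (Fin.last (m + 1))), wallShift]
      group
    rw [this]
    exact mul_mem (mul_mem (inv_mem hs) hf) (hw (elemMat_zero_mem_wallGroup m))

theorem isNontrivialAmalgamOver_E2ΓIncl :
    IsNontrivialAmalgamOver (E2ΓIncl (Nat.le_succ (m + 1))) := by
  let j := E2ΓIncl (Nat.le_succ (m + 1))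
  let ι : E2Γ (m + 1) →* (Matrix (Fin 2) (Fin 2) (Cliff (m + 2)))ˣ := (E2Γ (m + 2)).subtype.comp j
  have hjw : ∀ g, ι g ∈ wallGroup m := E2ΓIncl_mem_wallGroup m
  let f₁ : E2Γ (m + 1) →* flipGroup m :=
    ι.codRestrict (flipGroup m) fun g => (le_sup_left : wallGroup m ≤ _) (hjw g)
  let f₂ : E2Γ (m + 1) →* shiftGroup m :=
    ι.codRestrict (shiftGroup m) fun g => (le_sup_left : wallGroup m ≤ _) (hjw g)
  let φ₁ : flipGroup m →* E2Γ (m + 2) := Subgroup.inclusion (flipGroup_le m)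
  let φ₂ : shiftGroup m →* E2Γ (m + 2) := Subgroup.inclusion (shiftGroup_le m)
  have hr₁ : ∀ g : flipGroup m, g.1 ∈ wallGroup m → g ∈ f₁.range := by
    rintro ⟨_, _⟩ ⟨k, hk, rfl⟩
    exact ⟨⟨k, hk⟩, rfl⟩
  have hr₂ : ∀ g : shiftGroup m, g.1 ∈ wallGroup m → g ∈ f₂.range := by
    rintro ⟨_, _⟩ ⟨k, hk, rfl⟩
    exact ⟨⟨k, hk⟩, rfl⟩
  have hj : Function.Injective j := E2ΓIncl_injective _
  have hwall : ∀ g ∈ wallGroup m, ∀ X, X = wallVec m ∨ X = -wallVec m →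
      g.val * hermMat (m + 1) X * star g.val = hermMat (m + 1) X := by
    intro g hg X hX
    obtain ⟨f, hf, hga⟩ := wallGroup_le_actsSubgroup m hg
    rw [hga]
    have hf' : f (wallVec m) = wallVec m := hf
    rcases hX with rfl | rfl
    · rw [hf']
    · rw [map_neg, hf']
  have hflip : ∀ g ∈ flipGroup m, g ∉ wallGroup m →
      g.val * hermMat (m + 1) (wallVec m) * star g.val = hermMat (m + 1) (-wallVec m) := by
    intro g hg hgw
    have h1 := (mem_wallGroup_or_of_mem_flipGroup m hg).resolve_left hgw
    obtain ⟨f, hf, hga⟩ := wallGroup_le_actsSubgroup m h1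
    have h2 := (acts_wallFlip m).inv.mul hga
    rw [inv_mul_cancel_left] at h2
    have hf' : f (wallVec m) = wallVec m := hf
    have h3 := wallFlip_wallVec m
    rw [h2, LinearEquiv.mul_apply, hf', ← neg_neg (wallVec m), ← h3, map_neg, map_neg,
      ← LinearEquiv.mul_apply, inv_mul_cancel, h3]
    simp
  have hne : wallVec m ≠ -wallVec m := by
    intro h
    have := congrFun (congrArg (fun X => X.2.2) h) (Fin.last (m + 1))
    simp [wallVec] at this
  refine ⟨flipGroup m, shiftGroup m, inferInstance, inferInstance, f₁, f₂, ?_, ?_, ?_, ?_, ?_⟩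
  · intro a b h
    have h1 : ι a = ι b := congrArg (flipGroup m).subtype h
    exact hj (Subtype.ext h1)
  · intro a b h
    have h1 : ι a = ι b := congrArg (shiftGroup m).subtype h
    exact hj (Subtype.ext h1)
  · intro hs
    obtain ⟨g, hg⟩ := hs ⟨wallFlip m, (le_sup_right : _ ≤ flipGroup m) (Subgroup.mem_zpowers _)⟩
    have h1 : ι g = wallFlip m := congrArg Subtype.val hg
    refine not_mem_wallGroup_of_acts m (acts_wallFlip m) ?_ (h1 ▸ hjw g)
    rw [wallFlip_wallVec]
    exact hne.symm
  · intro hs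
    obtain ⟨g, hg⟩ := hs ⟨wallShift m, (le_sup_right : _ ≤ shiftGroup m) (Subgroup.mem_zpowers _)⟩
    have h1 : ι g = wallShift m := congrArg Subtype.val hg
    exact not_mem_wallGroup_of_acts m (acts_wallShift m) (wallShift_wallVec m) (h1 ▸ hjw g)
  · refine exists_amalgam_mulEquiv f₁ f₂ φ₁ φ₂ j (fun _ => rfl) (fun _ => rfl) hj ?_ (matAct m)
      ?_ ?_ (hermLT (m + 1)) (fun _ _ _ => hermLT.trans) hermLT.irrefl ?_
      (hermMat (m + 1) (wallVec m)) (hermMat (m + 1) (-wallVec m)) ?_ ?_ ?_ ?_ ?_ ?_ ?_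
    · refine Subgroup.map_injective (E2Γ (m + 2)).subtype_injective ?_
      rw [Subgroup.map_sup, ← MonoidHom.range_comp, ← MonoidHom.range_comp]
      have e1 : ((E2Γ (m + 2)).subtype.comp φ₁) = (flipGroup m).subtype := rfl
      have e2 : ((E2Γ (m + 2)).subtype.comp φ₂) = (shiftGroup m).subtype := rfl
      rw [e1, e2, Subgroup.range_subtype, Subgroup.range_subtype, ← MonoidHom.range_eq_map,
        Subgroup.range_subtype]
      exact le_antisymm (sup_le (flipGroup_le m) (shiftGroup_le m)) (E2Γ_le_sup m)
    · intro X
      simp [matAct]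
    · intro g k X
      simp only [matAct, Subgroup.coe_mul, Units.val_mul, star_mul, mul_assoc]
    · intro g X Y h
      exact h.mul_mul_star g.2
    · exact fun h => hne (hermMat_injective _ h)
    -- The difference of the two vectors is `±2 wallVec`, of positive norm, hence not in the cone:
    -- opposite sides of a wall are incomparable.
    · rw [hermLT_hermMat_iff]
      rintro ⟨⟨-, -, h⟩, -⟩
      simp only [map_sub, map_neg, LinearMap.sub_apply, LinearMap.neg_apply, hermForm_wallVec] at h
      simp [wallVec] at h
    · rw [hermLT_hermMat_iff]
      rintro ⟨⟨-, -, h⟩, -⟩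
      simp only [map_sub, map_neg, LinearMap.sub_apply, LinearMap.neg_apply, hermForm_wallVec] at h
      simp [wallVec] at h
    · exact fun g => hwall _ (hjw g) _ (.inl rfl)
    · exact fun g => hwall _ (hjw g) _ (.inr rfl)
    · intro g hg
      exact hflip g.1 g.2 fun h => hg (hr₁ g h)
    · intro g hg
      exact (mem_wallGroup_or_hermLT m g.2 (shiftGroup_le m g.2)).resolve_left
        fun h => hg (hr₂ g h)

end

/-! ### The case `n = 1`: the modular group. -/

noncomputable section

/-- The homomorphism from a cyclic group that maps the generator to `g`. -/
def zmodPow {G : Type*} [Group G] (n : ℕ) (g : G) (h : g ^ n = 1) : Multiplicative (ZMod n) →* G :=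
  AddMonoidHom.toMultiplicativeLeft (ZMod.lift n ⟨zmultiplesHom (Additive G) (Additive.ofMul g), by
    rw [zmultiplesHom_apply, natCast_zsmul, ← ofMul_pow, h, ofMul_one]⟩)

theorem zmodPow_ofAdd_natCast {G : Type*} [Group G] (n : ℕ) (g : G) (h : g ^ n = 1) (k : ℕ) :
    zmodPow n g h (Multiplicative.ofAdd (k : ZMod n)) = g ^ k := by
  have h1 : ZMod.lift n ⟨zmultiplesHom (Additive G) (Additive.ofMul g), by
      rw [zmultiplesHom_apply, natCast_zsmul, ← ofMul_pow, h, ofMul_one]⟩ (((k : ℤ) : ZMod n)) =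
      Additive.ofMul (g ^ k) := by
    rw [ZMod.lift_coe]
    simp
  rw [Int.cast_natCast] at h1
  exact congrArg Additive.toMul h1

section ModularGroup

open Matrix ModularGroup

/-- `SL₂(ℤ)` as a group of invertible matrices over the Clifford algebra. -/
def slToUnits : SpecialLinearGroup (Fin 2) ℤ →* (Matrix (Fin 2) (Fin 2) (Cliff 1))ˣ :=
  (Units.map ((Int.castRingHom (Cliff 1)).mapMatrix :
    Matrix (Fin 2) (Fin 2) ℤ →+* Matrix (Fin 2) (Fin 2) (Cliff 1))).comp SpecialLinearGroup.toGL

theorem slToUnits_apply (g : SpecialLinearGroup (Fin 2) ℤ) (i j : Fin 2) :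
    (slToUnits g).val i j = ((g : Matrix (Fin 2) (Fin 2) ℤ) i j : Cliff 1) := rfl

theorem slToUnits_injective : Function.Injective slToUnits := by
  intro g k h
  ext i j
  have h1 : ((g : Matrix (Fin 2) (Fin 2) ℤ) i j : Cliff 1) =
      ((k : Matrix (Fin 2) (Fin 2) ℤ) i j : Cliff 1) := by
    rw [← slToUnits_apply, h, slToUnits_apply]
  have h2 : algebraMap ℝ (Cliff 1) ((g : Matrix (Fin 2) (Fin 2) ℤ) i j : ℤ) =
      algebraMap ℝ (Cliff 1) ((k : Matrix (Fin 2) (Fin 2) ℤ) i j : ℤ) := by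
    simpa using h1
  exact_mod_cast (algebraMap ℝ (Cliff 1)).injective h2

theorem slToUnits_S : slToUnits S = (elemMat 0)⁻¹ := by
  have : (elemMat (0 : Cliff 1))⁻¹.val = !![0, -1; 1, 0] := rfl
  apply Units.ext
  rw [this]
  ext i j
  rw [slToUnits_apply, coe_S]
  fin_cases i <;> fin_cases j <;> simp

theorem slToUnits_T : slToUnits T = translMat (-1) := by
  apply Units.ext
  rw [translMat_val]
  ext i j
  rw [slToUnits_apply, coe_T]
  fin_cases i <;> fin_cases j <;> simp

/-- Generators are matched in both directions: `S` is the inverse of `E(0)`, and `T` is the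
translation `E(-1) E(0)⁻¹`. -/
theorem range_slToUnits : slToUnits.range = E2Γ 1 := by
  apply le_antisymm
  · rw [MonoidHom.range_eq_map, ← SpecialLinearGroup.SL2Z_generators, MonoidHom.map_closure,
      Subgroup.closure_le]
    rintro _ ⟨g, rfl | rfl, rfl⟩
    · rw [slToUnits_S]
      exact inv_mem (elemMat_zero_mem 1)
    · rw [slToUnits_T]
      have h1 : (-1 : Cliff 1) ∈ cliffVec 1 := neg_mem (paraUnit_mem 0 0)
      exact mul_mem (Subgroup.subset_closure ⟨_, h1, rfl⟩) (inv_mem (elemMat_zero_mem 1))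
  · have h0 : elemMat 0 ∈ slToUnits.range := ⟨S⁻¹, by rw [map_inv, slToUnits_S, inv_inv]⟩
    refine E2Γ_le_of_elemMat_mem (m := 0) h0 fun j => ?_
    rw [Fin.fin_one_eq_zero j, paraUnit_zero]
    have h1 : elemMat (-1 : Cliff 1) ∈ slToUnits.range := by
      rw [← translMat_mul_elemMat_zero, ← slToUnits_T]
      exact mul_mem ⟨T, rfl⟩ h0
    have := elemMat_neg (-1 : Cliff 1)
    rw [neg_neg] at this
    rw [this]
    exact mul_mem (mul_mem h0 (inv_mem h1)) h0

theorem nonempty_E2Γ_one_mulEquiv : Nonempty (E2Γ 1 ≃* SpecialLinearGroup (Fin 2) ℤ) :=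
  ⟨((MonoidHom.ofInjective slToUnits_injective).trans
    (MulEquiv.subgroupCongr range_slToUnits)).symm⟩

/-- The image of a set of vectors under an element of `SL₂(ℤ)`. -/
def slAct (g : SpecialLinearGroup (Fin 2) ℤ) (A : Set (Fin 2 → ℤ)) : Set (Fin 2 → ℤ) :=
  {v | ((g⁻¹ : SpecialLinearGroup (Fin 2) ℤ) : Matrix (Fin 2) (Fin 2) ℤ) *ᵥ v ∈ A}

theorem slAct_one (A : Set (Fin 2 → ℤ)) : slAct 1 A = A := by
  ext v
  simp [slAct]

theorem slAct_mul (g k : SpecialLinearGroup (Fin 2) ℤ) (A : Set (Fin 2 → ℤ)) :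
    slAct (g * k) A = slAct g (slAct k A) := by
  ext v
  have h : ((g * k)⁻¹ : SpecialLinearGroup (Fin 2) ℤ).1 = k⁻¹.1 * g⁻¹.1 :=
    congrArg Subtype.val (_root_.mul_inv_rev g k)
  change (g * k)⁻¹.1 *ᵥ v ∈ A ↔ k⁻¹.1 *ᵥ (g⁻¹.1 *ᵥ v) ∈ A
  rw [h, mulVec_mulVec]

theorem slAct_mono (g : SpecialLinearGroup (Fin 2) ℤ) {A B : Set (Fin 2 → ℤ)} (h : A ⊂ B) :
    slAct g A ⊂ slAct g B := by
  have hle : ∀ (g : SpecialLinearGroup (Fin 2) ℤ) {A B : Set (Fin 2 → ℤ)}, A ⊆ B →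
      slAct g A ⊆ slAct g B := fun g A B h v hv => h hv
  refine ⟨hle g h.1, fun h' => h.2 ?_⟩
  have := hle g⁻¹ h'
  rwa [← slAct_mul, ← slAct_mul, inv_mul_cancel, slAct_one, slAct_one] at this

/-- The vectors of positive slope. -/
def posSlope : Set (Fin 2 → ℤ) := {v | 0 < v 0 * v 1}

/-- The vectors of negative slope. -/
def negSlope : Set (Fin 2 → ℤ) := {v | v 0 * v 1 < 0}

theorem mem_slAct_posSlope (g : SpecialLinearGroup (Fin 2) ℤ) (v : Fin 2 → ℤ) :
    v ∈ slAct g posSlope ↔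
      0 < (g.1 1 1 * v 0 - g.1 0 1 * v 1) * (-g.1 1 0 * v 0 + g.1 0 0 * v 1) := by
  simp [slAct, posSlope, adjugate_fin_two, dotProduct,
    Fin.sum_univ_two, sub_eq_add_neg]

theorem mem_slAct_negSlope (g : SpecialLinearGroup (Fin 2) ℤ) (v : Fin 2 → ℤ) :
    v ∈ slAct g negSlope ↔
      (g.1 1 1 * v 0 - g.1 0 1 * v 1) * (-g.1 1 0 * v 0 + g.1 0 0 * v 1) < 0 := by
  simp [slAct, negSlope, adjugate_fin_two, dotProduct,
    Fin.sum_univ_two, sub_eq_add_neg]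

theorem S_pow_four : S ^ 4 = 1 := by
  decide

theorem T_mul_S_pow_six : (T * S) ^ 6 = 1 := by
  decide

theorem exists_amalgam_zmod_mulEquiv_SL2Z :
    ∃ (f₁ : Multiplicative (ZMod 2) →* Multiplicative (ZMod 4))
      (f₂ : Multiplicative (ZMod 2) →* Multiplicative (ZMod 6)),
      Function.Injective f₁ ∧ Function.Injective f₂ ∧
      ¬ Function.Surjective f₁ ∧ ¬ Function.Surjective f₂ ∧
      Nonempty (Amalgam f₁ f₂ ≃* SpecialLinearGroup (Fin 2) ℤ) := by
  let f₁ : Multiplicative (ZMod 2) →* Multiplicative (ZMod 4) :=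
    zmodPow 2 (Multiplicative.ofAdd 2) (by decide)
  let f₂ : Multiplicative (ZMod 2) →* Multiplicative (ZMod 6) :=
    zmodPow 2 (Multiplicative.ofAdd 3) (by decide)
  let φ₁ : Multiplicative (ZMod 4) →* SpecialLinearGroup (Fin 2) ℤ := zmodPow 4 S S_pow_four
  let φ₂ : Multiplicative (ZMod 6) →* SpecialLinearGroup (Fin 2) ℤ :=
    zmodPow 6 (T * S) T_mul_S_pow_six
  let j : Multiplicative (ZMod 2) →* SpecialLinearGroup (Fin 2) ℤ := zmodPow 2 (-1) (by simp)
  have hcases : ∀ h : Multiplicative (ZMod 2),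
      h = 1 ∨ h = Multiplicative.ofAdd ((1 : ℕ) : ZMod 2) :=
    by decide
  have f₁1 : f₁ (Multiplicative.ofAdd ((1 : ℕ) : ZMod 2)) =
      Multiplicative.ofAdd ((2 : ℕ) : ZMod 4) :=
    (zmodPow_ofAdd_natCast _ _ _ _).trans (by decide)
  have f₂1 : f₂ (Multiplicative.ofAdd ((1 : ℕ) : ZMod 2)) =
      Multiplicative.ofAdd ((3 : ℕ) : ZMod 6) :=
    (zmodPow_ofAdd_natCast _ _ _ _).trans (by decide)
  have j1 : j (Multiplicative.ofAdd ((1 : ℕ) : ZMod 2)) = -1 :=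
    (zmodPow_ofAdd_natCast _ _ _ _).trans (pow_one _)
  have φ₁k : ∀ k : ℕ, φ₁ (Multiplicative.ofAdd (k : ZMod 4)) = S ^ k := zmodPow_ofAdd_natCast _ _ _
  have φ₂k : ∀ k : ℕ, φ₂ (Multiplicative.ofAdd (k : ZMod 6)) = (T * S) ^ k :=
    zmodPow_ofAdd_natCast _ _ _
  have hr₁ : ∀ g, g ∉ f₁.range → g = Multiplicative.ofAdd ((1 : ℕ) : ZMod 4) ∨
      g = Multiplicative.ofAdd ((3 : ℕ) : ZMod 4) := by
    intro g hg
    have h0 : g ≠ 1 := by rintro rfl; exact hg (one_mem _)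
    have h2 : g ≠ Multiplicative.ofAdd ((2 : ℕ) : ZMod 4) := by rintro rfl; exact hg ⟨_, f₁1⟩
    clear hg
    revert g
    decide
  have hr₂ : ∀ g, g ∉ f₂.range → (g = Multiplicative.ofAdd ((1 : ℕ) : ZMod 6) ∨
      g = Multiplicative.ofAdd ((2 : ℕ) : ZMod 6)) ∨ (g = Multiplicative.ofAdd ((4 : ℕ) : ZMod 6) ∨
      g = Multiplicative.ofAdd ((5 : ℕ) : ZMod 6)) := by
    intro g hg
    have h0 : g ≠ 1 := by rintro rfl; exact hg (one_mem _)
    have h3 : g ≠ Multiplicative.ofAdd ((3 : ℕ) : ZMod 6) := by rintro rfl; exact hg ⟨_, f₂1⟩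
    clear hg
    revert g
    decide
  have hinj : ∀ {G : Type} [Group G] (f : Multiplicative (ZMod 2) →* G),
      f (Multiplicative.ofAdd ((1 : ℕ) : ZMod 2)) ≠ 1 → Function.Injective f := by
    intro G _ f hf
    rw [injective_iff_map_eq_one]
    intro h hh
    rcases hcases h with rfl | rfl
    · rfl
    · exact absurd hh hf
  refine ⟨f₁, f₂, hinj _ (by rw [f₁1]; decide), hinj _ (by rw [f₂1]; decide), ?_, ?_, ?_⟩
  · intro hs
    obtain ⟨h, hh⟩ := hs (Multiplicative.ofAdd 1)
    rcases hcases h with rfl | rfl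
    · rw [map_one] at hh; exact absurd hh (by decide)
    · rw [f₁1] at hh; exact absurd hh (by decide)
  · intro hs
    obtain ⟨h, hh⟩ := hs (Multiplicative.ofAdd 1)
    rcases hcases h with rfl | rfl
    · rw [map_one] at hh; exact absurd hh (by decide)
    · rw [f₂1] at hh; exact absurd hh (by decide)
  have hjact : ∀ h A, A = posSlope ∨ A = negSlope → slAct (j h) A = A := by
    intro h A hA
    rcases hcases h with rfl | rfl
    · rw [map_one, slAct_one]
    · rw [j1]
      ext v
      rcases hA with rfl | rfl
      · rw [mem_slAct_posSlope]; simp [posSlope]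
      · rw [mem_slAct_negSlope]; simp [negSlope]
  have hpn : ∀ {A : Set (Fin 2 → ℤ)}, (A = posSlope ∨ A = negSlope) → ∃ v, v ∈ A := by
    rintro A (rfl | rfl)
    · exact ⟨![1, 1], by simp [posSlope]⟩
    · exact ⟨![1, -1], by simp [negSlope]⟩
  have hdisj : ∀ v, v ∈ posSlope → v ∈ negSlope → False := fun v h h' =>
    lt_asymm (show 0 < v 0 * v 1 from h) h'
  have hS : ∀ g : SpecialLinearGroup (Fin 2) ℤ,
      g.1 = !![0, -1; 1, 0] ∨ g.1 = !![0, 1; -1, 0] →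
      slAct g posSlope = negSlope := by
    intro g hg
    ext v
    rw [mem_slAct_posSlope]
    rcases hg with hg | hg <;> rw [hg] <;> simp [negSlope, mul_comm]
  -- These are the four powers of `T * S` other than `1` and `-1`, that is, the elements of the
  -- second factor outside the amalgamated subgroup.
  have hU : ∀ g : SpecialLinearGroup (Fin 2) ℤ,
      (g.1 = !![1, -1; 1, 0] ∨ g.1 = !![0, -1; 1, -1]) ∨
      (g.1 = !![-1, 1; -1, 0] ∨ g.1 = !![0, 1; -1, 1]) →
      slAct g negSlope ⊂ posSlope := by
    intro g hg
    refine ⟨fun v hv => ?_, fun h => ?_⟩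
    · rw [mem_slAct_negSlope] at hv
      change 0 < v 0 * v 1
      rcases hg with (hg | hg) | (hg | hg) <;> rw [hg] at hv <;> simp at hv <;>
        -- In each case the hypothesis says that `v 0 ^ 2` or `v 1 ^ 2` is less than `v 0 * v 1`.
        nlinarith [sq_nonneg (v 0), sq_nonneg (v 1)]
    -- The inclusion is strict because at `(1, 1)` that inequality becomes an equality.
    · have h1 : (![1, 1] : Fin 2 → ℤ) ∈ posSlope := by simp [posSlope]
      have h2 := h h1
      rw [mem_slAct_negSlope] at h2
      rcases hg with (hg | hg) | (hg | hg) <;> rw [hg] at h2 <;> simp at h2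
  refine (exists_amalgam_mulEquiv f₁ f₂ φ₁ φ₂ j ?_ ?_ (hinj j (by rw [j1]; decide)) ?_ slAct
    slAct_one slAct_mul (· ⊂ ·) (fun _ _ _ => ssubset_trans) (fun _ => ssubset_irrefl _)
    (fun g _ _ h => slAct_mono g h) posSlope negSlope ?_ ?_ ?_ (fun h => hjact h _ (.inl rfl))
    (fun h => hjact h _ (.inr rfl)) ?_ ?_).nonempty
  · intro h
    rcases hcases h with rfl | rfl
    · simp
    · rw [f₁1, j1, φ₁k]
      decide
  · intro h
    rcases hcases h with rfl | rfl
    · simp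
    · rw [f₂1, j1, φ₂k]
      decide
  · rw [eq_top_iff, ← SpecialLinearGroup.SL2Z_generators, Subgroup.closure_le]
    have hSm : S ∈ φ₁.range ⊔ φ₂.range :=
      (le_sup_left : φ₁.range ≤ _) ⟨_, (φ₁k 1).trans (pow_one S)⟩
    have hUm : T * S ∈ φ₁.range ⊔ φ₂.range :=
      (le_sup_right : φ₂.range ≤ _) ⟨_, (φ₂k 1).trans (pow_one _)⟩
    rintro _ (rfl | rfl)
    · exact hSm
    · exact (Subgroup.mul_mem_cancel_right _ hSm).1 hUm
  · intro h
    obtain ⟨v, hv⟩ := hpn (.inl rfl)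
    exact hdisj v hv (h ▸ hv)
  · intro h
    obtain ⟨v, hv⟩ := hpn (.inl rfl)
    exact hdisj v hv (h.1 hv)
  · intro h
    obtain ⟨v, hv⟩ := hpn (.inr rfl)
    exact hdisj v (h.1 hv) hv
  · intro g hg
    rcases hr₁ g hg with rfl | rfl <;> rw [φ₁k] <;> apply hS <;> decide
  · intro g hg
    rcases hr₂ g hg with (rfl | rfl) | (rfl | rfl) <;> rw [φ₂k] <;> apply hU <;> decide

end ModularGroup

theorem theorem5p6 :
    (∀ n : ℕ, 1 ≤ n → IsNontrivialAmalgam (E2Γ n)) ∧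
    (∀ n : ℕ, 2 ≤ n → IsNontrivialAmalgamOver (E2ΓIncl (Nat.sub_le n 1))) ∧
    Nonempty (E2Γ 1 ≃* Matrix.SpecialLinearGroup (Fin 2) ℤ) ∧
    (∃ (f₁ : Multiplicative (ZMod 2) →* Multiplicative (ZMod 4))
      (f₂ : Multiplicative (ZMod 2) →* Multiplicative (ZMod 6)),
      Function.Injective f₁ ∧ Function.Injective f₂ ∧
      ¬ Function.Surjective f₁ ∧ ¬ Function.Surjective f₂ ∧
      Nonempty (Amalgam f₁ f₂ ≃* E2Γ 1)) := by
  obtain ⟨e⟩ := nonempty_E2Γ_one_mulEquiv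
  obtain ⟨f₁, f₂, h₁, h₂, hs₁, hs₂, ⟨e'⟩⟩ := exists_amalgam_zmod_mulEquiv_SL2Z
  have hover : ∀ n : ℕ, 2 ≤ n → IsNontrivialAmalgamOver (E2ΓIncl (Nat.sub_le n 1)) := by
    intro n hn
    obtain ⟨m, rfl⟩ := Nat.exists_eq_add_of_le' hn
    exact isNontrivialAmalgamOver_E2ΓIncl m
  refine ⟨fun n hn => ?_, hover, ⟨e⟩, f₁, f₂, h₁, h₂, hs₁, hs₂, ⟨e'.trans e.symm⟩⟩
  rcases hn.eq_or_lt with rfl | hn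
  -- For `n = 1` there is no smaller elementary group; the splitting of the modular group over `C₂`
  -- is used instead.
  · exact ⟨_, _, (e'.trans e.symm).toMonoidHom.comp (Amalgam.base f₁ f₂), _, _, _, _, f₁, f₂, h₁,
      h₂, hs₁, hs₂, e'.trans e.symm, fun _ => rfl⟩
  · exact ⟨_, _, _, hover n hn⟩
end
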